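/- **The algorithm.** Let $G$ be a finite simple graph with $n$ nodes and maximum degree $\Delta\ge 3$; $\log$ is to base $2$. Let $T=c\log\Delta$ be of the form $T=R\cdot 2^L$ with integers $R,L\ge 0$ and $2\log\log\Delta<R\le 4\log\log\Delta$, and let $k=\lceil 12\,C\log\Delta\rceil$. The *recursive MIS algorithm* runs $T$ iterations. These iterations form one phase of length $T$, and every phase of length greater than $R$ is split into two subphases of half its length, so that the phases have lengths $R2^i$, $0\le i\le L$. Initially all nodes $v$ are present and $p_0(v)=1/2$. In iteration $t=1,\dots,T$, with $N(v)$ the set of remaining neighbors of $v$, all remaining nodes do the following. 1. In each of $k$ independent repetitions, every node $u$ is sampled independently with probability $p_{t-1}(u)$; $\hat d_{t-1}(v)$ is the median, over the repetitions, of the number of sampled nodes in $N(v)$. 2. For each phase beginning in iteration $t$, from the longest to the shortest: if $v$ is not already stalling in an enclosing phase and $\hat d_{t-1}(v)>2^{2\ell}$, where $\ell$ is the length of the phase, then $v$ stalls in all iterations of that phase. 3. $p_t(v)=p_{t-1}(v)/2$ if $\hat d_{t-1}(v)\ge 2$ or $v$ is stalling, and $p_t(v)=\min\{2p_{t-1}(v),1/2\}$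 otherwise. 4. Every non-stalling node $v$ marks itself independently with probability $p_t(v)$. A marked node without a marked neighbor joins the MIS, and it is removed from the graph together with its neighbors. The sampling and marking decisions are made by comparing $p_{t-1}(v)$ and $p_t(v)$ with independent uniform random numbers in $[0,1)$ of $b>T$ bits; each node has $k+1$ fresh such numbers in every iteration, and these form the randomness of the node. **Theorem.** There are absolute constants $c_0,C_0,K>0$ such that the following holds for all $c\ge c_0$ and $C\ge C_0$ and all $G,R,L,b$ as above. 1. For each node $v$, with probability at least $1-1/\Delta^{98}$, node $v$ or a neighbor of $v$ is added to the MIS during the $T=c\log\Delta$ iterations. This guarantee is independent of the randomness outside the $2$-hop neighborhood of $v$: the probability is at least $1-1/\Delta^{98}$ also conditioned on any fixed values of the random numbers of all nodes at distance more than $2$ from $v$. 2. Let $B$ be the set of nodes remaining after the $T$ iterations. With probability at least $1-1/n^{10}$, every connected component of the subgraph of $G$ induced by $B$ has at most $K\cdot\log_\Delta n\cdot\Delta^4$ nodes. -/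

import Mathlib

open MeasureTheory ProbabilityTheory

namespace RecursiveMIS

/-- The median of `k` natural numbers: the mean of the two middle entries (which coincide when `k`
is odd) after sorting. -/
noncomputable def median {k : ℕ} (a : Fin k → ℕ) : ℝ :=
  if h : 0 < k then
    ((a (Tuple.sort a ⟨(k - 1) / 2, by omega⟩) : ℝ) + (a (Tuple.sort a ⟨k / 2, by omega⟩) : ℝ)) / 2
  else 0

/-- A uniformly random number of `[0, 1)` with `b`-bit precision; `r` stands for `r / 2 ^ b`. -/
abbrev Number (b : ℕ) : Type := Fin (2 ^ b)

/-- The real number that `r` stands for. -/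
noncomputable def Number.val {b : ℕ} (r : Number b) : ℝ := ((Fin.val r : ℕ) : ℝ) / 2 ^ b

/-- The randomness of one node in one iteration: one number for each of the `k` repetitions of the
sampling, and one number for the marking. -/
abbrev IterCoins (k b : ℕ) : Type := (Fin k → Number b) × Number b

/-- The randomness of a whole execution of `T` iterations: fresh coins for every node and every
iteration. -/
abbrev Coins (V : Type*) (T k b : ℕ) : Type _ := V → Fin T → IterCoins k b

/-- All random numbers are independent and uniform. -/
noncomputable def coinMeasure (V : Type*) (T k b : ℕ) : Measure (Coins V T k b) :=
  uniformOn Set.univ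

/-- The state between two iterations. -/
structure State (V : Type*) where
  /-- the nodes that have not been removed -/
  alive : Finset V
  /-- the nodes that have joined the independent set -/
  mis : Finset V
  /-- the current probabilities `p_t(v)` -/
  p : V → ℝ
  /-- a node `v` stalls in all iterations (numbered from `0`) before `stallEnd v` -/
  stallEnd : V → ℕ

section Algorithm

variable {V : Type*} [Fintype V] [DecidableEq V] (G : SimpleGraph V) [DecidableRel G.Adj]

/-- Before the first iteration: all nodes are present, `p_0 = 1/2`, nobody stalls. -/
noncomputable def initState (V : Type*) [Fintype V] : State V where
  alive := Finset.univ
  mis := ∅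
  p := fun _ => 1 / 2
  stallEnd := fun _ => 0

/-- The number of remaining neighbors of `v` that are sampled in repetition `j`, where a node is
sampled when its random number is below its current probability. -/
noncomputable def sampleCount {k b : ℕ} (ρ : V → IterCoins k b) (σ : State V) (v : V)
    (j : Fin k) : ℕ :=
  open Classical in
  ((G.neighborFinset v ∩ σ.alive).filter (fun u => ((ρ u).1 j).val < σ.p u)).card

/-- The estimate `d̂(v)`: the median of the counts over the `k` repetitions. -/
noncomputable def estimate {k b : ℕ} (ρ : V → IterCoins k b) (σ : State V) (v : V) : ℝ :=
  median (sampleCount G ρ σ v)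

/-- The end of the stalling period of `v` that is in force in iteration `τ` (numbered from `0`).
The phases have lengths `R * 2 ^ i` with `i ≤ L`, and a phase of that length begins in iteration
`τ` exactly when `R * 2 ^ i ∣ τ`.  A node that is still stalling in an enclosing phase goes on
stalling.  Any other node tests the phases that begin now, from the longest to the shortest, and
stalls until the end of the first one with `d̂(v) > 2 ^ (2 * length)`, if there is one. -/
noncomputable def newStallEnd (R L : ℕ) {k b : ℕ} (τ : ℕ) (ρ : V → IterCoins k b) (σ : State V)
    (v : V) : ℕ :=
  open Classical in
  if τ < σ.stallEnd v then σ.stallEnd v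
  else ((Finset.range (L + 1)).filter (fun i =>
      R * 2 ^ i ∣ τ ∧ (2 : ℝ) ^ (2 * (R * 2 ^ i)) < estimate G ρ σ v)).sup (fun i => τ + R * 2 ^ i)

/-- Whether `v` stalls in iteration `τ`. -/
def Stalling (R L : ℕ) {k b : ℕ} (τ : ℕ) (ρ : V → IterCoins k b) (σ : State V) (v : V) : Prop :=
  τ < newStallEnd G R L τ ρ σ v

/-- The update of the probability of `v` (round 1). -/
noncomputable def newP (R L : ℕ) {k b : ℕ} (τ : ℕ) (ρ : V → IterCoins k b) (σ : State V)
    (v : V) : ℝ :=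
  open Classical in
  if 2 ≤ estimate G ρ σ v ∨ Stalling G R L τ ρ σ v then σ.p v / 2 else min (2 * σ.p v) (1 / 2)

/-- Whether `v` marks itself (round 2): only remaining nodes that do not stall do so, with
probability the new value of `p`. -/
def Marked (R L : ℕ) {k b : ℕ} (τ : ℕ) (ρ : V → IterCoins k b) (σ : State V) (v : V) : Prop :=
  v ∈ σ.alive ∧ ¬ Stalling G R L τ ρ σ v ∧ (ρ v).2.val < newP G R L τ ρ σ v

/-- The nodes that join the independent set in iteration `τ`: the marked nodes without a marked
neighbor. -/
noncomputable def joining (R L : ℕ) {k b : ℕ} (τ : ℕ) (ρ : V → IterCoins k b) (σ : State V) :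
    Finset V :=
  open Classical in
  Finset.univ.filter (fun v =>
    Marked G R L τ ρ σ v ∧ ∀ u, G.Adj v u → ¬ Marked G R L τ ρ σ u)

/-- Iteration `τ` (numbered from `0`) of the algorithm, with the coins `ρ` of that iteration. -/
noncomputable def step (R L : ℕ) {k b : ℕ} (τ : ℕ) (ρ : V → IterCoins k b) (σ : State V) :
    State V where
  alive := open Classical in σ.alive.filter (fun v =>
    v ∉ joining G R L τ ρ σ ∧ ∀ u, G.Adj v u → u ∉ joining G R L τ ρ σ)
  mis := σ.mis ∪ joining G R L τ ρ σ
  p := newP G R L τ ρ σ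
  stallEnd := newStallEnd G R L τ ρ σ

/-- The state after the first `t` iterations of the recursive MIS algorithm with `R * 2 ^ L`
iterations, where the phases are halved recursively from length `R * 2 ^ L` down to length `R`. -/
noncomputable def stateAt (R L : ℕ) {k b : ℕ} (ω : Coins V (R * 2 ^ L) k b) : ℕ → State V
  | 0 => initState V
  | t + 1 =>
    if h : t < R * 2 ^ L then step G R L t (fun v => ω v ⟨t, h⟩) (stateAt R L ω t)
    else stateAt R L ω t

/-- The state at the end of the execution. -/
noncomputable def finalState (R L : ℕ) {k b : ℕ} (ω : Coins V (R * 2 ^ L) k b) : State V :=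
  stateAt G R L ω (R * 2 ^ L)

/-- The event that `v` or a neighbor of `v` is added to the independent set during the execution. -/
def covered (R L k b : ℕ) (v : V) : Set (Coins V (R * 2 ^ L) k b) :=
  {ω | v ∈ (finalState G R L ω).mis ∨ ∃ u, G.Adj v u ∧ u ∈ (finalState G R L ω).mis}

/-- The set of nodes remaining at the end of the execution. -/
noncomputable def remaining (R L : ℕ) {k b : ℕ} (ω : Coins V (R * 2 ^ L) k b) : Finset V :=
  (finalState G R L ω).alive

/-- The event that every connected component of the subgraph induced by the remaining nodes has at
most `s` nodes. -/
def componentsAtMost (R L k b : ℕ) (s : ℝ) : Set (Coins V (R * 2 ^ L) k b) :=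
  {ω | ∀ K : (G.induce (remaining G R L ω : Set V)).ConnectedComponent,
    (K.supp.ncard : ℝ) ≤ s}

/-- The event that all nodes outside the `2`-hop neighborhood of `v` have the coins given by `η`. -/
def outsideCoins {T k b : ℕ} (v : V) (η : Coins V T k b) : Set (Coins V T k b) :=
  {ω | ∀ u, ¬ G.edist v u ≤ 2 → ω u = η u}

end Algorithm

end RecursiveMIS

/-! Fix a node `v`. An iteration is golden for `v` if the remaining, non-stalling nodes of effective
degree below 12 in its closed neighborhood have total updated probability at least `1/8000`. This is
decided by the samples alone; the markings are still fresh, and in a golden iteration `v` is removed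
with probability at least the constant `hitProb` (`avg_not_success_le`).

Golden iterations cannot be rare. `potential` combines the logarithm of the effective degree of `v`,
the rest of its stalling period and `-log p(v)`. Without a relevant estimation error it drops by at
least 1 in an iteration that is not golden and rises by at most 9 in a golden one
(`potential_step_le`). A stall of length `l` requires a degree level of at least `2 * l`, so it is
already paid for; this is all the argument needs about the phases. The potential starts at `O(log
Δ)` and is never negative, so a constant fraction of the first `O(log Δ)` iterations is golden
unless an error occurs (`le_sum_golden`).

The probabilities are controlled by a supermartingale. The indicator that an iteration does not
succeed is multiplied by `(1 - hitProb)⁻¹` if the iteration is golden and by `1 + M` if there is an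
error. Its conditional mean is at most `1 + M (Δ + 1) 5^(-k)` (`avg_stepWeight_le`), while for a
survivor and `M = (1 - hitProb)^(-m)` the product is at least `M` (`le_prod_runWeight`). Markov's
inequality gives a survival probability of at most `Δ^(-99)`. In each iteration only coins of the
2-hop neighborhood are averaged, for an arbitrary past and arbitrary outside coins. Hence the bound
holds conditionally on the outside, and it multiplies for nodes with disjoint 2-hop neighborhoods
(`avg_alive_le_pow`).

For shattering, a large component contains `s + 1` nodes at pairwise distance more than 4, each new
one within distance 5 of an earlier one (`exists_separated_list`). Such a set is recorded by a list
of `2 * s + 1` nodes with steps of length at most 5. There are at most `n (Δ + 1)^(10 s)` lists, and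
each survives with probability at most `Δ^(-99 (s + 1))`. -/

set_option linter.unusedSectionVars false

/-! ### Indicators and averages over blocks of coordinates. -/

namespace RecursiveMIS

/-- The indicator of a proposition. -/
noncomputable def ind (P : Prop) : ℝ := open Classical in if P then 1 else 0

lemma ind_of {P : Prop} (h : P) : ind P = 1 := by simp [ind, h]

lemma ind_of_not {P : Prop} (h : ¬ P) : ind P = 0 := by simp [ind, h]

lemma ind_nonneg (P : Prop) : 0 ≤ ind P := by unfold ind; split_ifs <;> norm_num

lemma ind_le_one (P : Prop) : ind P ≤ 1 := by unfold ind; split_ifs <;> norm_num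

lemma ind_mono {P Q : Prop} (h : P → Q) : ind P ≤ ind Q := by
  by_cases hP : P
  · rw [ind_of hP, ind_of (h hP)]
  · rw [ind_of_not hP]; exact ind_nonneg Q

lemma ind_congr {P Q : Prop} (h : P ↔ Q) : ind P = ind Q := by rw [propext h]

lemma ind_not (P : Prop) : ind (¬ P) = 1 - ind P := by
  by_cases h : P <;> simp [ind, h]

lemma ind_forall_mem {κ : Type*} (S : Finset κ) (P : κ → Prop) :
    ind (∀ i ∈ S, P i) = ∏ i ∈ S, ind (P i) := by
  by_cases h : ∀ i ∈ S, P i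
  · rw [ind_of h, Finset.prod_eq_one fun i hi => ind_of (h i hi)]
  · rw [ind_of_not h]
    push Not at h
    obtain ⟨i, hi, hP⟩ := h
    exact (Finset.prod_eq_zero hi (ind_of_not hP)).symm

lemma ind_le_sum {κ : Type*} {S : Finset κ} {Q : Prop} {P : κ → Prop}
    (h : Q → ∃ i ∈ S, P i) : ind Q ≤ ∑ i ∈ S, ind (P i) := by
  by_cases hQ : Q
  · obtain ⟨i, hi, hP⟩ := h hQ
    calc ind Q ≤ 1 := ind_le_one Q
      _ = ind (P i) := (ind_of hP).symm
      _ ≤ _ := Finset.single_le_sum (f := fun i => ind (P i)) (fun j _ => ind_nonneg _) hi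
  · rw [ind_of_not hQ]; exact Finset.sum_nonneg fun i _ => ind_nonneg _

lemma sum_ind_le {κ : Type*} {S : Finset κ} {Q : Prop} {P : κ → Prop}
    (h : ∀ i ∈ S, P i → Q) (hd : ∀ i ∈ S, ∀ j ∈ S, P i → P j → i = j) :
    ∑ i ∈ S, ind (P i) ≤ ind Q := by
  by_cases hex : ∃ i ∈ S, P i
  · obtain ⟨i, hi, hP⟩ := hex
    rw [ind_of (h i hi hP), Finset.sum_eq_single_of_mem i hi, ind_of hP]
    exact fun j hj hne => ind_of_not fun hPj => hne (hd j hj i hi hPj hP)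
  · push Not at hex
    rw [Finset.sum_eq_zero fun i hi => ind_of_not (hex i hi)]
    exact ind_nonneg Q

section Average

variable {ι α κ : Type*} [DecidableEq ι] [Fintype α]

open scoped BigOperators in
/-- The average of `f` over the coordinates in `s`, where the other coordinates are those of `x`. -/
noncomputable def avg (s : Finset ι) (f : (ι → α) → ℝ) (x : ι → α) : ℝ :=
  Finset.expect Finset.univ fun y : s → α => f (Function.updateFinset x s y)

lemma updateFinset_of_notMem (s : Finset ι) (x : ι → α) (y : s → α) {i : ι} (hi : i ∉ s) :
    Function.updateFinset x s y i = x i := by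
  simp [Function.updateFinset, hi]

lemma avg_congr {s : Finset ι} {f g : (ι → α) → ℝ} {x : ι → α}
    (h : ∀ z, (∀ i, i ∉ s → z i = x i) → f z = g z) : avg s f x = avg s g x :=
  Finset.expect_congr rfl fun y _ => h _ fun _ hi => updateFinset_of_notMem s x y hi

lemma avg_mono {s : Finset ι} {f g : (ι → α) → ℝ} {x : ι → α}
    (h : ∀ z, (∀ i, i ∉ s → z i = x i) → f z ≤ g z) : avg s f x ≤ avg s g x :=
  Finset.expect_le_expect fun y _ => h _ fun _ hi => updateFinset_of_notMem s x y hi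

lemma avg_const [Nonempty α] (s : Finset ι) (c : ℝ) (x : ι → α) : avg s (fun _ => c) x = c :=
  Fintype.expect_const c

/-- The analogue of pulling a known factor out of a conditional expectation: `g` ignores the
averaged coordinates. -/
lemma avg_mul_left {s : Finset ι} {f g : (ι → α) → ℝ} {x : ι → α}
    (h : ∀ z, (∀ i, i ∉ s → z i = x i) → g z = g x) :
    avg s (fun z => g z * f z) x = g x * avg s f x := by
  rw [avg, avg, Finset.mul_expect]
  exact Finset.expect_congr rfl fun y _ => by
    rw [h _ fun _ hi => updateFinset_of_notMem s x y hi]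

lemma avg_const_mul (s : Finset ι) (c : ℝ) (f : (ι → α) → ℝ) (x : ι → α) :
    avg s (fun z => c * f z) x = c * avg s f x :=
  avg_mul_left (g := fun _ => c) fun _ _ => rfl

lemma avg_add (s : Finset ι) (f g : (ι → α) → ℝ) (x : ι → α) :
    avg s (fun z => f z + g z) x = avg s f x + avg s g x :=
  Finset.expect_add_distrib _ _ _

lemma avg_sub (s : Finset ι) (f g : (ι → α) → ℝ) (x : ι → α) :
    avg s (fun z => f z - g z) x = avg s f x - avg s g x :=
  Finset.expect_sub_distrib _ _ _

lemma avg_sum (s : Finset ι) (S : Finset κ) (f : κ → (ι → α) → ℝ) (x : ι → α) :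
    avg s (fun z => ∑ i ∈ S, f i z) x = ∑ i ∈ S, avg s (f i) x :=
  Finset.expect_sum_comm _ _ _

/-- The tower property; it permits averaging iteration by iteration, and samples before markings. -/
lemma avg_union {s t : Finset ι} (h : Disjoint s t) (f : (ι → α) → ℝ) (x : ι → α) :
    avg (s ∪ t) f x = avg s (avg t f) x := by
  simp only [avg]
  rw [← Fintype.expect_equiv (Equiv.piFinsetUnion (fun _ => α) h)
    (fun y => f (Function.updateFinset (Function.updateFinset x s y.1) t y.2)) _
    (fun y => by rw [Function.updateFinset_updateFinset h]),
    ← Finset.univ_product_univ, Finset.expect_product]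

lemma avg_le_of_forall_le [Nonempty α] {s : Finset ι} {f : (ι → α) → ℝ} {x : ι → α} {c : ℝ}
    (h : ∀ z, (∀ i, i ∉ s → z i = x i) → f z ≤ c) : avg s f x ≤ c :=
  (avg_mono (g := fun _ => c) h).trans_eq (avg_const s c x)

/-- Iterated averages: a bound for the inner average gives one for the outer average. -/
lemma avg_le_of_subset [Nonempty α] {s t : Finset ι} (hst : s ⊆ t) {f : (ι → α) → ℝ} {x : ι → α}
    {c : ℝ} (h : ∀ z, (∀ i, i ∉ t → z i = x i) → avg s f z ≤ c) : avg t f x ≤ c := by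
  rw [← Finset.sdiff_union_of_subset hst, avg_union Finset.sdiff_disjoint]
  exact avg_le_of_forall_le fun z hz => h z fun i hi =>
    hz i fun hi' => hi (Finset.sdiff_subset hi')

lemma avg_eq_of_subset [Nonempty α] {s t : Finset ι} (hst : s ⊆ t) {f : (ι → α) → ℝ} {x : ι → α}
    {c : ℝ} (h : ∀ z, (∀ i, i ∉ t → z i = x i) → avg s f z = c) : avg t f x = c := by
  rw [← Finset.sdiff_union_of_subset hst, avg_union Finset.sdiff_disjoint,
    avg_congr (g := fun _ => c), avg_const]
  exact fun z hz => h z fun i hi => hz i fun hi' => hi (Finset.sdiff_subset hi')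

/-- Independence in a conditional form: inside `A` each factor reads only its own block, and the
coordinates outside `A` are frozen. The blocks are averaged out one at a time. -/
lemma avg_prod_le [Nonempty α] [DecidableEq κ] (S : Finset κ) (B : κ → Finset ι)
    (f : κ → (ι → α) → ℝ) (c : κ → ℝ) (hc : ∀ v ∈ S, 0 ≤ c v) (hf : ∀ v ∈ S, ∀ z, 0 ≤ f v z)
    (hd : ∀ u ∈ S, ∀ v ∈ S, u ≠ v → Disjoint (B u) (B v)) (x : ι → α) (A : Finset ι)
    (hB : ∀ v ∈ S, B v ⊆ A)
    (hloc : ∀ v ∈ S, ∀ z z' : ι → α, (∀ i, i ∈ B v ∨ i ∉ A → z i = z' i) → f v z = f v z')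
    (havg : ∀ v ∈ S, ∀ z, (∀ i, i ∉ A → z i = x i) → avg (B v) (f v) z ≤ c v) :
    avg A (fun z => ∏ v ∈ S, f v z) x ≤ ∏ v ∈ S, c v := by
  induction S using Finset.induction_on generalizing A with
  | empty => simpa using (avg_const A 1 x).le
  | insert a S ha ih =>
    have haS := Finset.mem_insert_self a S
    have hsub : ∀ {v}, v ∈ S → v ∈ insert a S := fun h => Finset.mem_insert_of_mem h
    rw [← Finset.sdiff_union_of_subset (hB a haS), avg_union Finset.sdiff_disjoint]
    have hloc' : ∀ v ∈ S, ∀ z z' : ι → α, (∀ i, i ∉ B a → z i = z' i) → f v z = f v z' := by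
      intro v hv z z' hz
      refine hloc v (hsub hv) z z' fun i hi => hz i fun hia => ?_
      rcases hi with hi | hi
      · exact Finset.disjoint_left.mp (hd a haS v (hsub hv) (by rintro rfl; exact ha hv)) hia hi
      · exact hi (hB a haS hia)
    calc avg (A \ B a) (avg (B a) fun z => ∏ v ∈ insert a S, f v z) x
        = avg (A \ B a) (fun z => (∏ v ∈ S, f v z) * avg (B a) (f a) z) x := by
          refine avg_congr fun z hz => ?_
          rw [← avg_mul_left (g := fun z => ∏ v ∈ S, f v z)]
          · exact avg_congr fun z' _ => by rw [Finset.prod_insert ha, mul_comm]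
          · exact fun z' hz' => Finset.prod_congr rfl fun v hv => hloc' v hv _ _ hz'
      _ ≤ avg (A \ B a) (fun z => (∏ v ∈ S, f v z) * c a) x := by
          refine avg_mono fun z hz => mul_le_mul_of_nonneg_left (havg a haS z fun i hi => hz i ?_)
            (Finset.prod_nonneg fun v hv => hf v (hsub hv) z)
          exact fun hi' => hi (Finset.sdiff_subset hi')
      _ = c a * avg (A \ B a) (fun z => ∏ v ∈ S, f v z) x := by
          rw [← avg_const_mul]; simp only [mul_comm]
      _ ≤ c a * ∏ v ∈ S, c v := by
          refine mul_le_mul_of_nonneg_left ?_ (hc a haS)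
          refine ih (fun v hv => hc v (hsub hv)) (fun v hv => hf v (hsub hv))
            (fun u hu v hv => hd u (hsub hu) v (hsub hv)) (A \ B a)
            (fun v hv => Finset.subset_sdiff.mpr ⟨hB v (hsub hv),
              hd v (hsub hv) a haS (by rintro rfl; exact ha hv)⟩)
            (fun v hv z z' hz => hloc v (hsub hv) z z' fun i hi => hz i ?_)
            (fun v hv z hz => havg v (hsub hv) z fun i hi => hz i ?_)
          · exact hi.imp_right fun hi hi' => hi (Finset.sdiff_subset hi')
          · exact fun hi' => hi (Finset.sdiff_subset hi')
      _ = _ := by rw [Finset.prod_insert ha]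

lemma avg_prod_eq [Nonempty α] [DecidableEq κ] (S : Finset κ) (B : κ → Finset ι)
    (f : κ → (ι → α) → ℝ) (c : κ → ℝ)
    (hd : ∀ u ∈ S, ∀ v ∈ S, u ≠ v → Disjoint (B u) (B v)) (x : ι → α) (A : Finset ι)
    (hB : ∀ v ∈ S, B v ⊆ A)
    (hloc : ∀ v ∈ S, ∀ z z' : ι → α, (∀ i, i ∈ B v ∨ i ∉ A → z i = z' i) → f v z = f v z')
    (havg : ∀ v ∈ S, ∀ z, (∀ i, i ∉ A → z i = x i) → avg (B v) (f v) z = c v) :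
    avg A (fun z => ∏ v ∈ S, f v z) x = ∏ v ∈ S, c v := by
  induction S using Finset.induction_on generalizing A with
  | empty => simpa using avg_const A 1 x
  | insert a S ha ih =>
    have haS := Finset.mem_insert_self a S
    have hsub : ∀ {v}, v ∈ S → v ∈ insert a S := fun h => Finset.mem_insert_of_mem h
    rw [← Finset.sdiff_union_of_subset (hB a haS), avg_union Finset.sdiff_disjoint]
    have hloc' : ∀ v ∈ S, ∀ z z' : ι → α, (∀ i, i ∉ B a → z i = z' i) → f v z = f v z' := by
      intro v hv z z' hz
      refine hloc v (hsub hv) z z' fun i hi => hz i fun hia => ?_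
      rcases hi with hi | hi
      · exact Finset.disjoint_left.mp (hd a haS v (hsub hv) (by rintro rfl; exact ha hv)) hia hi
      · exact hi (hB a haS hia)
    calc avg (A \ B a) (avg (B a) fun z => ∏ v ∈ insert a S, f v z) x
        = avg (A \ B a) (fun z => c a * ∏ v ∈ S, f v z) x := by
          refine avg_congr fun z hz => ?_
          rw [← havg a haS z fun i hi => hz i fun hi' => hi (Finset.sdiff_subset hi'), mul_comm,
            ← avg_mul_left (g := fun z => ∏ v ∈ S, f v z)]
          · exact avg_congr fun z' _ => by rw [Finset.prod_insert ha, mul_comm]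
          · exact fun z' hz' => Finset.prod_congr rfl fun v hv => hloc' v hv _ _ hz'
      _ = c a * avg (A \ B a) (fun z => ∏ v ∈ S, f v z) x := avg_const_mul _ _ _ _
      _ = c a * ∏ v ∈ S, c v := by
          congr 1
          refine ih (fun u hu v hv => hd u (hsub hu) v (hsub hv)) (A \ B a)
            (fun v hv => Finset.subset_sdiff.mpr ⟨hB v (hsub hv),
              hd v (hsub hv) a haS (by rintro rfl; exact ha hv)⟩)
            (fun v hv z z' hz => hloc v (hsub hv) z z' fun i hi => hz i ?_)
            (fun v hv z hz => havg v (hsub hv) z fun i hi => hz i ?_)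
          · exact hi.imp_right fun hi hi' => hi (Finset.sdiff_subset hi')
          · exact fun hi' => hi (Finset.sdiff_subset hi')
      _ = _ := by rw [Finset.prod_insert ha]

lemma avg_singleton (i : ι) (f : (ι → α) → ℝ) (x : ι → α) :
    avg {i} f x = Finset.expect Finset.univ fun a : α => f (Function.update x i a) := by
  rw [avg]
  refine Fintype.expect_equiv (Equiv.funUnique ({i} : Finset ι) α) _ _ fun y => ?_
  rw [Function.updateFinset_singleton]
  rfl

end Average

end RecursiveMIS

/-! ### Medians, exact comparison with random numbers, and the quality of the estimates. -/

namespace RecursiveMIS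

/-- The larger of the two middle entries exceeds `r`, and so does everything sorted after it, which
is at least half of the entries. -/
lemma card_le_of_lt_median {k : ℕ} (a : Fin k → ℕ) {r : ℝ} (h : r < median a) :
    k ≤ 2 * (Finset.univ.filter fun j => r < (a j : ℝ)).card := by
  rcases Nat.eq_zero_or_pos k with rfl | hk
  · simp
  rw [median, dif_pos hk] at h
  have hm := Tuple.monotone_sort a
  set s := Tuple.sort a
  have hmid : r < (a (s ⟨k / 2, by omega⟩) : ℝ) := by
    have : (a (s ⟨(k - 1) / 2, by omega⟩) : ℝ) ≤ a (s ⟨k / 2, by omega⟩) :=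
      Nat.cast_le.mpr (hm (Fin.mk_le_mk.mpr (by omega)))
    linarith
  have hsub : (Finset.Ici (⟨k / 2, by omega⟩ : Fin k)).map s.toEmbedding ⊆
      Finset.univ.filter fun j => r < (a j : ℝ) := by
    intro j hj
    obtain ⟨i, hi, rfl⟩ := Finset.mem_map.mp hj
    have : (a (s ⟨k / 2, by omega⟩) : ℝ) ≤ a (s i) :=
      Nat.cast_le.mpr (hm (Finset.mem_Ici.mp hi))
    simpa using hmid.trans_le this
  have hcard := Finset.card_le_card hsub
  rw [Finset.card_map, Fin.card_Ici] at hcard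
  simp only at hcard
  omega

lemma card_le_of_median_lt {k : ℕ} (a : Fin k → ℕ) {r : ℝ} (h : median a < r) :
    k ≤ 2 * (Finset.univ.filter fun j => (a j : ℝ) < r).card := by
  rcases Nat.eq_zero_or_pos k with rfl | hk
  · simp
  rw [median, dif_pos hk] at h
  have hm := Tuple.monotone_sort a
  set s := Tuple.sort a
  have hmid : (a (s ⟨(k - 1) / 2, by omega⟩) : ℝ) < r := by
    have : (a (s ⟨(k - 1) / 2, by omega⟩) : ℝ) ≤ a (s ⟨k / 2, by omega⟩) :=
      Nat.cast_le.mpr (hm (Fin.mk_le_mk.mpr (by omega)))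
    linarith
  have hsub : (Finset.Iic (⟨(k - 1) / 2, by omega⟩ : Fin k)).map s.toEmbedding ⊆
      Finset.univ.filter fun j => (a j : ℝ) < r := by
    intro j hj
    obtain ⟨i, hi, rfl⟩ := Finset.mem_map.mp hj
    have : (a (s i) : ℝ) ≤ a (s ⟨(k - 1) / 2, by omega⟩) :=
      Nat.cast_le.mpr (hm (Finset.mem_Iic.mp hi))
    simpa using this.trans_lt hmid
  have hcard := Finset.card_le_card hsub
  rw [Finset.card_map, Fin.card_Iic] at hcard
  simp only at hcard
  omega

/-- The threshold is a multiple of the grid width `2^(-b)`, so exactly `2^(b-j)` values lie below it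
and there is no rounding error. -/
lemma expect_ind_val_lt {b j : ℕ} (hj : j ≤ b) :
    (Finset.expect Finset.univ fun r : Number b => ind (r.val < (1 / 2) ^ j)) = (1 / 2) ^ j := by
  have hiff : ∀ r : Number b, r.val < (1 / 2) ^ j ↔ (r : ℕ) < 2 ^ (b - j) := by
    intro r
    have h2 : (2 : ℝ) ^ b = 2 ^ (b - j) * 2 ^ j := by rw [← pow_add]; congr 1; omega
    rw [Number.val, div_lt_iff₀ (by positivity), h2, one_div, inv_pow, mul_comm, mul_assoc,
      mul_inv_cancel₀ (by positivity), mul_one]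
    exact_mod_cast Iff.rfl
  rw [Fintype.expect_eq_sum_div_card, Fintype.card_fin]
  simp only [hiff, ind]
  rw [Finset.sum_boole]
  have hcard : (Finset.univ.filter fun r : Number b => (r : ℕ) < 2 ^ (b - j)).card
      = 2 ^ (b - j) := by
    rw [Fin.card_filter_val_lt]
    exact min_eq_right (Nat.pow_le_pow_right (by norm_num) (Nat.sub_le b j))
  have h2 : (2 : ℝ) ^ b = 2 ^ (b - j) * 2 ^ j := by rw [← pow_add]; congr 1; omega
  rw [show (_ : Finset (Number b)).card = 2 ^ (b - j) by convert hcard]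
  push_cast
  rw [h2, one_div, inv_pow]
  field_simp

/-- Positive powers of `1 / 2` that a random number of `b` bits can be compared with exactly. -/
def Dyadic (b : ℕ) (q : ℝ) : Prop := ∃ j, 1 ≤ j ∧ j ≤ b ∧ q = (1 / 2) ^ j

lemma Dyadic.pos {b : ℕ} {q : ℝ} (h : Dyadic b q) : 0 < q := by
  obtain ⟨j, _, _, rfl⟩ := h; positivity

lemma Dyadic.le_half {b : ℕ} {q : ℝ} (h : Dyadic b q) : q ≤ 1 / 2 := by
  obtain ⟨j, h1, _, rfl⟩ := h
  simpa using pow_le_pow_of_le_one (by norm_num : (0 : ℝ) ≤ 1 / 2) (by norm_num) h1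

lemma avg_ind_val_lt {ι : Type*} [DecidableEq ι] {b : ℕ} {q : ℝ} (hq : Dyadic b q)
    {A : Finset ι} {i : ι} (hi : i ∈ A) (x : ι → Number b) :
    avg A (fun x => ind ((x i).val < q)) x = q := by
  refine avg_eq_of_subset (Finset.singleton_subset_iff.mpr hi) fun z _ => ?_
  obtain ⟨j, _, hj, rfl⟩ := hq
  rw [avg_singleton]
  simp only [Function.update_self]
  exact expect_ind_val_lt hj

section Sampling

variable {V : Type*} [Fintype V] [DecidableEq V] (G : SimpleGraph V) [DecidableRel G.Adj]
variable {T k b : ℕ}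

/-- The index of a random number: iteration, node, and repetition (or `none` for the marking). -/
abbrev CoinIndex (V : Type*) (T k : ℕ) : Type _ := Fin T × V × Option (Fin k)

/-- The coins of iteration `t`. -/
def coinsAt (t : Fin T) (x : CoinIndex V T k → Number b) : V → IterCoins k b :=
  fun v => (fun j => x (t, v, some j), x (t, v, none))

/-- The closed neighborhood. -/
def closedNbhd (v : V) : Finset V := insert v (G.neighborFinset v)

/-- The nodes at distance at most two. -/
def closedNbhd₂ (v : V) : Finset V := (closedNbhd G v).biUnion (closedNbhd G)

/-- The sum of the probabilities of the remaining neighbors. -/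
noncomputable def effDeg (σ : State V) (v : V) : ℝ := ∑ w ∈ G.neighborFinset v ∩ σ.alive, σ.p w

lemma self_mem_closedNbhd (v : V) : v ∈ closedNbhd G v := Finset.mem_insert_self _ _

lemma neighborFinset_subset_closedNbhd (v : V) : G.neighborFinset v ⊆ closedNbhd G v :=
  Finset.subset_insert _ _

lemma closedNbhd_subset_closedNbhd₂ {u v : V} (h : u ∈ closedNbhd G v) :
    closedNbhd G u ⊆ closedNbhd₂ G v :=
  Finset.subset_biUnion_of_mem (closedNbhd G) h

lemma neighborFinset_subset_closedNbhd₂ {u v : V} (h : u ∈ closedNbhd G v) :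
    G.neighborFinset u ⊆ closedNbhd₂ G v :=
  (neighborFinset_subset_closedNbhd G u).trans (closedNbhd_subset_closedNbhd₂ G h)

/-- The coordinates of the samples of the nodes of `W` in iteration `t`. -/
def sampleBlock (t : Fin T) (W : Finset V) : Finset (CoinIndex V T k) :=
  {t} ×ˢ W ×ˢ Finset.univ.map Function.Embedding.some

/-- The coordinates of the samples of the nodes of `W` in repetition `j` of iteration `t`. -/
def repBlock (t : Fin T) (W : Finset V) (j : Fin k) : Finset (CoinIndex V T k) :=
  {t} ×ˢ W ×ˢ {some j}

lemma mem_repBlock {t : Fin T} {W : Finset V} {j : Fin k} {i : CoinIndex V T k} :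
    i ∈ repBlock t W j ↔ i.1 = t ∧ i.2.1 ∈ W ∧ i.2.2 = some j := by
  simp only [repBlock, Finset.mem_product, Finset.mem_singleton]

lemma mem_sampleBlock {t : Fin T} {W : Finset V} {i : CoinIndex V T k} :
    i ∈ sampleBlock t W ↔ i.1 = t ∧ i.2.1 ∈ W ∧ ∃ j, i.2.2 = some j := by
  simp only [sampleBlock, Finset.mem_product, Finset.mem_singleton, Finset.mem_map,
    Finset.mem_univ, true_and, Function.Embedding.some_apply, eq_comm]

lemma repBlock_subset (t : Fin T) (W : Finset V) (j : Fin k) :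
    repBlock t W j ⊆ sampleBlock t W := by
  intro i hi
  rw [mem_repBlock] at hi
  exact mem_sampleBlock.mpr ⟨hi.1, hi.2.1, j, hi.2.2⟩

lemma sampleCount_eq_sum (ρ : V → IterCoins k b) (σ : State V) (v : V) (j : Fin k) :
    (sampleCount G ρ σ v j : ℝ) =
      ∑ u ∈ G.neighborFinset v ∩ σ.alive, ind (((ρ u).1 j).val < σ.p u) := by
  simp only [sampleCount, ind]
  rw [Finset.sum_boole]

lemma sampleCount_congr {t : Fin T} {W : Finset V} {σ : State V} {v : V} {j : Fin k}
    (hW : G.neighborFinset v ⊆ W) {x y : CoinIndex V T k → Number b}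
    (h : ∀ i ∈ repBlock t W j, x i = y i) :
    sampleCount G (coinsAt t x) σ v j = sampleCount G (coinsAt t y) σ v j := by
  rw [← Nat.cast_inj (R := ℝ), sampleCount_eq_sum, sampleCount_eq_sum]
  refine Finset.sum_congr rfl fun u hu => ?_
  simp only [coinsAt]
  rw [h (t, u, some j) (mem_repBlock.mpr ⟨rfl, hW (Finset.inter_subset_left hu), rfl⟩)]

lemma estimate_congr {t : Fin T} {W : Finset V} {σ : State V} {v : V}
    (hW : G.neighborFinset v ⊆ W) {x y : CoinIndex V T k → Number b}
    (h : ∀ i ∈ sampleBlock t W, x i = y i) :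
    estimate G (coinsAt t x) σ v = estimate G (coinsAt t y) σ v := by
  unfold estimate
  congr 1
  funext j
  exact sampleCount_congr G hW fun i hi => h i (repBlock_subset t W j hi)

lemma effDeg_nonneg {σ : State V} (hp : ∀ u, Dyadic b (σ.p u)) (v : V) : 0 ≤ effDeg G σ v :=
  Finset.sum_nonneg fun u _ => (hp u).pos.le

lemma avg_sampleCount {σ : State V} (hp : ∀ u, Dyadic b (σ.p u)) {W : Finset V} {v : V}
    (hW : G.neighborFinset v ⊆ W) (t : Fin T) (j : Fin k) (x : CoinIndex V T k → Number b) :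
    avg (repBlock t W j) (fun x => (sampleCount G (coinsAt t x) σ v j : ℝ)) x
      = effDeg G σ v := by
  simp only [sampleCount_eq_sum]
  rw [avg_sum, effDeg]
  refine Finset.sum_congr rfl fun u hu => ?_
  have hmem : (t, u, some j) ∈ repBlock t W j :=
    mem_repBlock.mpr ⟨rfl, hW (Finset.inter_subset_left hu), rfl⟩
  exact avg_ind_val_lt (i := (t, u, some j)) (hp u) hmem x

/-- Markov's inequality, the mean being `effDeg`. Effective degree zero is treated separately: all
probabilities are positive, so there is then no remaining neighbor to sample. -/
lemma avg_sampleCount_large {σ : State V} (hp : ∀ u, Dyadic b (σ.p u)) {W : Finset V} {v : V}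
    (hW : G.neighborFinset v ⊆ W) (t : Fin T) (j : Fin k) (x : CoinIndex V T k → Number b) :
    avg (repBlock t W j) (fun x =>
      ind (100 * effDeg G σ v < (sampleCount G (coinsAt t x) σ v j : ℝ))) x ≤ 1 / 100 := by
  rcases (effDeg_nonneg G hp v).eq_or_lt with h0 | hpos
  · refine avg_le_of_forall_le fun z _ => ?_
    have hempty : G.neighborFinset v ∩ σ.alive = ∅ := by
      by_contra hne
      have := Finset.sum_pos (fun u _ => (hp u).pos) (Finset.nonempty_iff_ne_empty.mpr hne)
      exact absurd h0 this.ne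
    rw [ind_of_not (by rw [sampleCount_eq_sum, hempty, ← h0]; simp)]
    norm_num
  · calc avg (repBlock t W j) (fun x =>
          ind (100 * effDeg G σ v < (sampleCount G (coinsAt t x) σ v j : ℝ))) x
        ≤ avg (repBlock t W j) (fun x => (1 / (100 * effDeg G σ v)) *
            (sampleCount G (coinsAt t x) σ v j : ℝ)) x := by
          refine avg_mono fun z _ => ?_
          by_cases h : 100 * effDeg G σ v < (sampleCount G (coinsAt t z) σ v j : ℝ)
          · rw [ind_of h, one_div_mul_eq_div, le_div_iff₀ (by positivity)]
            linarith
          · rw [ind_of_not h]; positivity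
      _ = 1 / 100 := by
          rw [avg_const_mul, avg_sampleCount G hp hW]
          field_simp

lemma two_mul_exp_neg_six_le : 2 * Real.exp (-6) ≤ 1 / 100 := by
  have h1 : (2.7 : ℝ) ^ 6 ≤ Real.exp 6 := by
    rw [show (6 : ℝ) = ((6 : ℕ) : ℝ) * 1 by norm_num, Real.exp_nat_mul]
    gcongr
    have := Real.exp_one_gt_d9
    linarith
  rw [Real.exp_neg, ← div_eq_mul_inv, div_le_iff₀ (Real.exp_pos 6)]
  norm_num at h1 ⊢
  linarith

/-- Markov's inequality for `2^(-X)`, where `X` is the count: `X < 2` means `X ≤ 1`, hence `2^(-X) ≥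
1/2`. By independence the mean is `∏ (1 - p/2) ≤ exp (-d/2)`, and `d ≥ 12` makes the bound `2 exp
(-6)`. -/
lemma avg_sampleCount_small {σ : State V} (hp : ∀ u, Dyadic b (σ.p u)) {W : Finset V} {v : V}
    (hW : G.neighborFinset v ⊆ W) (hd : 12 ≤ effDeg G σ v) (t : Fin T) (j : Fin k)
    (x : CoinIndex V T k → Number b) :
    avg (repBlock t W j) (fun x =>
      ind ((sampleCount G (coinsAt t x) σ v j : ℝ) < 2)) x ≤ 1 / 100 := by
  set N := G.neighborFinset v ∩ σ.alive with hN
  calc avg (repBlock t W j) (fun x =>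
        ind ((sampleCount G (coinsAt t x) σ v j : ℝ) < 2)) x
      ≤ avg (repBlock t W j) (fun x => 2 * ∏ u ∈ N,
          (1 - ind ((x (t, u, some j)).val < σ.p u) / 2)) x := by
        refine avg_mono fun z _ => ?_
        have hprod : ∏ u ∈ N, (1 - ind ((z (t, u, some j)).val < σ.p u) / 2)
            = (1 / 2 : ℝ) ^ (sampleCount G (coinsAt t z) σ v j) := by
          classical
          rw [sampleCount, ← Finset.prod_const, Finset.prod_filter]
          refine Finset.prod_congr (by rw [hN]) fun u _ => ?_
          by_cases h : (z (t, u, some j)).val < σ.p u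
          · rw [ind_of h, if_pos (by exact h)]; norm_num
          · rw [ind_of_not h, if_neg (by exact h)]; norm_num
        rw [hprod]
        by_cases h : (sampleCount G (coinsAt t z) σ v j : ℝ) < 2
        · rw [ind_of h]
          have h1 : sampleCount G (coinsAt t z) σ v j ≤ 1 := by
            have : sampleCount G (coinsAt t z) σ v j < 2 := by exact_mod_cast h
            omega
          have := pow_le_pow_of_le_one (by norm_num : (0 : ℝ) ≤ 1 / 2) (by norm_num) h1
          linarith
        · rw [ind_of_not h]; positivity
    _ = 2 * ∏ u ∈ N, (1 - σ.p u / 2) := by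
        rw [avg_const_mul, avg_prod_eq N (fun u => {(t, u, some j)})]
        · intro u _ w _ hne
          simpa using hne
        · intro u hu
          simpa using mem_repBlock.mpr ⟨rfl, hW (Finset.inter_subset_left hu), rfl⟩
        · intro u _ z z' hz
          rw [hz _ (Or.inl (Finset.mem_singleton_self _))]
        · intro u _ z _
          rw [avg_sub, avg_const]
          simp only [div_eq_inv_mul]
          rw [avg_const_mul, avg_ind_val_lt (hp u) (Finset.mem_singleton_self _)]
    _ ≤ 2 * Real.exp (-6) := by
        gcongr
        calc ∏ u ∈ N, (1 - σ.p u / 2) ≤ ∏ u ∈ N, Real.exp (-(σ.p u / 2)) := by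
              refine Finset.prod_le_prod (fun u _ => ?_) fun u _ => ?_
              · linarith [(hp u).le_half]
              · linarith [Real.add_one_le_exp (-(σ.p u / 2))]
          _ = Real.exp (-(effDeg G σ v / 2)) := by
              rw [← Real.exp_sum, Finset.sum_neg_distrib, ← Finset.sum_div]; rfl
          _ ≤ _ := Real.exp_le_exp.mpr (by linarith)
    _ ≤ 1 / 100 := two_mul_exp_neg_six_le

/-- Boosting by repetition: an event that needs half of the repetitions to be exceptional. -/
lemma avg_majority_le (t : Fin T) (W : Finset V) (Q : Fin k → (CoinIndex V T k → Number b) → Prop)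
    (E : (CoinIndex V T k → Number b) → Prop)
    (hQ : ∀ j x y, (∀ i ∈ repBlock t W j, x i = y i) → (Q j x ↔ Q j y))
    (havg : ∀ j x, avg (repBlock t W j) (fun x => ind (Q j x)) x ≤ 1 / 100)
    (hE : ∀ x, E x → ∃ J : Finset (Fin k), k ≤ 2 * J.card ∧ ∀ j ∈ J, Q j x)
    (x : CoinIndex V T k → Number b) :
    avg (sampleBlock t W) (fun x => ind (E x)) x ≤ (1 / 5) ^ k := by
  -- Union bound over the possible sets of exceptional repetitions: there are at most `2^k`, and
  -- each has probability at most `100^(-|J|) ≤ 10^(-k)`.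
  set 𝒥 := (Finset.univ : Finset (Finset (Fin k))).filter fun J => k ≤ 2 * J.card
  calc avg (sampleBlock t W) (fun x => ind (E x)) x
      ≤ avg (sampleBlock t W) (fun x => ∑ J ∈ 𝒥, ∏ j ∈ J, ind (Q j x)) x := by
        refine avg_mono fun z _ => ?_
        simp only [← ind_forall_mem]
        refine ind_le_sum fun h => ?_
        obtain ⟨J, h1, h2⟩ := hE z h
        exact ⟨J, Finset.mem_filter.mpr ⟨Finset.mem_univ _, h1⟩, h2⟩
    _ = ∑ J ∈ 𝒥, avg (sampleBlock t W) (fun x => ∏ j ∈ J, ind (Q j x)) x := avg_sum _ _ _ _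
    _ ≤ ∑ J ∈ 𝒥, (1 / 10) ^ k := by
        refine Finset.sum_le_sum fun J hJ => ?_
        calc avg (sampleBlock t W) (fun x => ∏ j ∈ J, ind (Q j x)) x
            ≤ ∏ j ∈ J, (1 / 100 : ℝ) := by
              refine avg_prod_le J (repBlock t W) (fun j x => ind (Q j x)) _
                (fun _ _ => by norm_num) (fun _ _ _ => ind_nonneg _) ?_ x _
                (fun j _ => repBlock_subset t W j) ?_ (fun j _ z _ => havg j z)
              · intro j _ j' _ hne
                refine Finset.disjoint_left.mpr fun i hi hi' => hne ?_
                rw [mem_repBlock] at hi hi'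
                exact Option.some.inj (hi.2.2.symm.trans hi'.2.2)
              · exact fun j _ z z' hz => ind_congr (hQ j z z' fun i hi => hz i (Or.inl hi))
          _ = (1 / 10) ^ (2 * J.card) := by
              rw [Finset.prod_const, pow_mul]; norm_num
          _ ≤ (1 / 10) ^ k :=
              pow_le_pow_of_le_one (by norm_num) (by norm_num) (Finset.mem_filter.mp hJ).2
    _ ≤ 2 ^ k * (1 / 10) ^ k := by
        rw [Finset.sum_const, nsmul_eq_mul]
        gcongr
        have : 𝒥.card ≤ 2 ^ k := by
          simpa using Finset.card_filter_le (Finset.univ : Finset (Finset (Fin k))) _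
        exact_mod_cast this
    _ = (1 / 5) ^ k := by rw [← mul_pow]; norm_num

/-- An estimate in the neighborhood of `v` is so wrong that it matters for `v`. -/
def EstimateError (σ : State V) (ρ : V → IterCoins k b) (v : V) : Prop :=
  100 * effDeg G σ v < estimate G ρ σ v ∨
    ∃ u ∈ G.neighborFinset v, 12 ≤ effDeg G σ u ∧ estimate G ρ σ u < 2

lemma estimateError_congr {t : Fin T} {σ : State V} {v : V} {x y : CoinIndex V T k → Number b}
    (h : ∀ i ∈ sampleBlock t (closedNbhd₂ G v), x i = y i) :
    EstimateError G σ (coinsAt t x) v ↔ EstimateError G σ (coinsAt t y) v := by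
  unfold EstimateError
  rw [estimate_congr G
    (neighborFinset_subset_closedNbhd₂ G (self_mem_closedNbhd G v)) h]
  refine or_congr Iff.rfl (exists_congr fun u => and_congr_right fun hu => ?_)
  rw [estimate_congr G
    (neighborFinset_subset_closedNbhd₂ G (neighborFinset_subset_closedNbhd G v hu)) h]

/-- At most `Δ + 1` estimates are involved, that of `v` and those of its neighbors, and all of them
read samples within distance two only. -/
lemma avg_estimateError_le {σ : State V} (hp : ∀ u, Dyadic b (σ.p u)) (v : V) (t : Fin T)
    (x : CoinIndex V T k → Number b) :
    avg (sampleBlock t (closedNbhd₂ G v)) (fun x => ind (EstimateError G σ (coinsAt t x) v)) x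
      ≤ (G.maxDegree + 1) * (1 / 5) ^ k := by
  set A : Finset (CoinIndex V T k) := sampleBlock t (closedNbhd₂ G v)
  have hv := neighborFinset_subset_closedNbhd₂ G (self_mem_closedNbhd G v)
  have h1 : avg A (fun x => ind (100 * effDeg G σ v < estimate G (coinsAt t x) σ v)) x
      ≤ (1 / 5) ^ k := by
    refine avg_majority_le t _ (fun j x =>
      100 * effDeg G σ v < (sampleCount G (coinsAt t x) σ v j : ℝ)) _ ?_ ?_ ?_ x
    · intro j x y h
      rw [sampleCount_congr G hv h]
    · exact fun j x => avg_sampleCount_large G hp hv t j x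
    · exact fun x h => ⟨_, card_le_of_lt_median _ h, fun j hj => (Finset.mem_filter.mp hj).2⟩
  have h2 : ∀ u ∈ G.neighborFinset v, avg A (fun x =>
      ind (12 ≤ effDeg G σ u ∧ estimate G (coinsAt t x) σ u < 2)) x ≤ (1 / 5) ^ k := by
    intro u hu
    have hu' := neighborFinset_subset_closedNbhd₂ G (neighborFinset_subset_closedNbhd G v hu)
    by_cases hd : 12 ≤ effDeg G σ u
    · simp only [hd, true_and]
      refine avg_majority_le t _ (fun j x => (sampleCount G (coinsAt t x) σ u j : ℝ) < 2)
        _ ?_ ?_ ?_ x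
      · intro j x y h
        rw [sampleCount_congr G hu' h]
      · exact fun j x => avg_sampleCount_small G hp hu' hd t j x
      · exact fun x h => ⟨_, card_le_of_median_lt _ h, fun j hj => (Finset.mem_filter.mp hj).2⟩
    · refine avg_le_of_forall_le fun z _ => ?_
      rw [ind_of_not (fun h => hd h.1)]
      positivity
  calc avg A (fun x => ind (EstimateError G σ (coinsAt t x) v)) x
      ≤ avg A (fun x => ind (100 * effDeg G σ v < estimate G (coinsAt t x) σ v) +
          ∑ u ∈ G.neighborFinset v,
            ind (12 ≤ effDeg G σ u ∧ estimate G (coinsAt t x) σ u < 2)) x := by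
        refine avg_mono fun z _ => ?_
        by_cases h : 100 * effDeg G σ v < estimate G (coinsAt t z) σ v
        · rw [ind_of h]
          exact (ind_le_one _).trans
            (le_add_of_nonneg_right (Finset.sum_nonneg fun _ _ => ind_nonneg _))
        · rw [ind_of_not h, zero_add]
          exact ind_le_sum fun hE => hE.resolve_left h
    _ ≤ (1 / 5) ^ k + ∑ u ∈ G.neighborFinset v, (1 / 5) ^ k := by
        rw [avg_add, avg_sum]
        exact add_le_add h1 (Finset.sum_le_sum h2)
    _ = (G.degree v + 1) * (1 / 5) ^ k := by
        rw [Finset.sum_const, nsmul_eq_mul, SimpleGraph.card_neighborFinset_eq_degree]; ring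
    _ ≤ _ := by
        gcongr
        exact_mod_cast G.degree_le_maxDegree v

end Sampling

end RecursiveMIS

/-! ### The potential and its drift in one iteration. -/

namespace RecursiveMIS

/-- A logarithmic measure of the effective degree that vanishes below `1 / 200`. -/
noncomputable def degreeLevel (d : ℝ) : ℝ := if d < 1 / 200 then 0 else Real.logb 2 (200 * d) + 1

lemma degreeLevel_of_lt {d : ℝ} (h : d < 1 / 200) : degreeLevel d = 0 := if_pos h

lemma degreeLevel_of_le {d : ℝ} (h : 1 / 200 ≤ d) : degreeLevel d = Real.logb 2 (200 * d) + 1 :=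
  if_neg (not_lt.mpr h)

lemma one_le_degreeLevel {d : ℝ} (h : 1 / 200 ≤ d) : 1 ≤ degreeLevel d := by
  rw [degreeLevel_of_le h]
  have := Real.logb_nonneg (b := 2) (x := 200 * d) (by norm_num) (by linarith)
  linarith

lemma degreeLevel_nonneg (d : ℝ) : 0 ≤ degreeLevel d := by
  rcases lt_or_ge d (1 / 200) with h | h
  · rw [degreeLevel_of_lt h]
  · linarith [one_le_degreeLevel h]

/-- Doubling adds 1 above the threshold. If the threshold is crossed, then `200 * d' < 2`, so the
new level is at most 2. -/
lemma degreeLevel_le_add_two {d d' : ℝ} (h : d' ≤ 2 * d) :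
    degreeLevel d' ≤ degreeLevel d + 2 := by
  rcases lt_or_ge d' (1 / 200) with h' | h'
  · rw [degreeLevel_of_lt h']; linarith [degreeLevel_nonneg d]
  rw [degreeLevel_of_le h']
  have hmono : Real.logb 2 (200 * d') ≤ Real.logb 2 (2 * (200 * d)) :=
    Real.logb_le_logb_of_le (by norm_num) (by linarith) (by linarith)
  rw [Real.logb_mul (x := 2) (y := 200 * d) (by norm_num) (by linarith),
    Real.logb_self_eq_one (by norm_num)] at hmono
  rcases lt_or_ge d (1 / 200) with hd | hd
  · rw [degreeLevel_of_lt hd]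
    have : Real.logb 2 (200 * d) ≤ Real.logb 2 1 :=
      Real.logb_le_logb_of_le (by norm_num) (by linarith) (by linarith)
    rw [Real.logb_one] at this
    linarith
  · rw [degreeLevel_of_le hd]; linarith

/-- Above the threshold the factor counts because `(13/20)^2 < 1/2`. If `d'` falls below the
threshold, the jump of height 1 built into `degreeLevel` is more than enough. -/
lemma degreeLevel_le_sub_half {d d' : ℝ} (hd : 1 / 200 ≤ d) (h : d' ≤ 13 / 20 * d) :
    degreeLevel d' ≤ degreeLevel d - 1 / 2 := by
  rcases lt_or_ge d' (1 / 200) with h' | h'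
  · rw [degreeLevel_of_lt h']; linarith [one_le_degreeLevel hd]
  rw [degreeLevel_of_le h', degreeLevel_of_le hd]
  have hmono : Real.logb 2 (200 * d') ≤ Real.logb 2 (13 / 20 * (200 * d)) :=
    Real.logb_le_logb_of_le (by norm_num) (by linarith) (by linarith)
  rw [Real.logb_mul (x := 13 / 20) (y := 200 * d) (by norm_num) (by linarith)] at hmono
  have hc : Real.logb 2 (13 / 20) ≤ -1 / 2 := by
    have h2 : Real.logb 2 ((13 / 20) ^ 2) ≤ Real.logb 2 (2⁻¹) :=
      Real.logb_le_logb_of_le (by norm_num) (by norm_num) (by norm_num)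
    rw [Real.logb_pow, Real.logb_inv, Real.logb_self_eq_one (by norm_num)] at h2
    push_cast at h2
    linarith
  linarith

/-- With an estimate of at most `100 * d`, passing the stalling test for a phase of length `l`
forces a degree level that covers the whole stall in `potential`. -/
lemma two_mul_le_degreeLevel {d : ℝ} {l : ℕ} (h : 2 ^ (2 * l) < 100 * d) :
    1 / 200 ≤ d ∧ 2 * (l : ℝ) ≤ degreeLevel d := by
  have h1 : (1 : ℝ) ≤ 2 ^ (2 * l) := one_le_pow₀ (by norm_num)
  have hd : 1 / 200 ≤ d := by linarith
  refine ⟨hd, ?_⟩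
  rw [degreeLevel_of_le hd]
  have hmono : Real.logb 2 (2 ^ (2 * l)) ≤ Real.logb 2 (200 * d) :=
    Real.logb_le_logb_of_le (by norm_num) (by positivity) (by linarith)
  rw [Real.logb_pow, Real.logb_self_eq_one (by norm_num)] at hmono
  push_cast at hmono
  linarith

lemma neg_logb_half (p : ℝ) (hp : 0 < p) : -Real.logb 2 (p / 2) = -Real.logb 2 p + 1 := by
  rw [Real.logb_div hp.ne' (by norm_num), Real.logb_self_eq_one (by norm_num)]; ring

lemma neg_logb_two_mul (p : ℝ) (hp : 0 < p) : -Real.logb 2 (2 * p) = -Real.logb 2 p - 1 := by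
  rw [Real.logb_mul (by norm_num) hp.ne', Real.logb_self_eq_one (by norm_num)]; ring

section Step

variable {V : Type*} [Fintype V] [DecidableEq V] (G : SimpleGraph V) [DecidableRel G.Adj]
variable {k b : ℕ} (R L τ : ℕ) (ρ : V → IterCoins k b) (σ : State V)

/-- The remaining nodes near `v` that do not stall and have small effective degree. -/
noncomputable def lightNodes (v : V) : Finset V :=
  open Classical in
  (closedNbhd G v).filter fun u =>
    u ∈ σ.alive ∧ ¬ Stalling G R L τ ρ σ u ∧ effDeg G σ u < 12

/-- In a golden iteration the neighborhood of `v` has a constant chance to be hit. -/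
def Golden (v : V) : Prop := 1 / 8000 ≤ ∑ u ∈ lightNodes G R L τ ρ σ v, newP G R L τ ρ σ u

variable {R L τ ρ σ}

lemma mem_lightNodes {u v : V} : u ∈ lightNodes G R L τ ρ σ v ↔
    u ∈ closedNbhd G v ∧ u ∈ σ.alive ∧ ¬ Stalling G R L τ ρ σ u ∧ effDeg G σ u < 12 := by
  simp [lightNodes]

lemma newP_of_halving {u : V} (h : 2 ≤ estimate G ρ σ u ∨ Stalling G R L τ ρ σ u) :
    newP G R L τ ρ σ u = σ.p u / 2 := by
  rw [newP, if_pos h]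

lemma newP_of_not_halving {u : V} (h : ¬ (2 ≤ estimate G ρ σ u ∨ Stalling G R L τ ρ σ u)) :
    newP G R L τ ρ σ u = min (2 * σ.p u) (1 / 2) := by
  rw [newP, if_neg h]

lemma newP_le {u : V} (hp : Dyadic b (σ.p u)) :
    newP G R L τ ρ σ u ≤ min (2 * σ.p u) (1 / 2) := by
  by_cases h : 2 ≤ estimate G ρ σ u ∨ Stalling G R L τ ρ σ u
  · rw [newP_of_halving G h]
    exact le_min (by linarith [hp.pos]) (by linarith [hp.le_half, hp.pos])
  · rw [newP_of_not_halving G h]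

lemma half_le_newP {u : V} (hp : Dyadic b (σ.p u)) : σ.p u / 2 ≤ newP G R L τ ρ σ u := by
  by_cases h : 2 ≤ estimate G ρ σ u ∨ Stalling G R L τ ρ σ u
  · rw [newP_of_halving G h]
  · rw [newP_of_not_halving G h]
    exact le_min (by linarith [hp.pos]) (by linarith [hp.le_half, hp.pos])

lemma newP_pos {u : V} (hp : Dyadic b (σ.p u)) : 0 < newP G R L τ ρ σ u :=
  (half_pos hp.pos).trans_le (half_le_newP G hp)

lemma effDeg_step_le_sum (hp : ∀ u, Dyadic b (σ.p u)) (v : V) :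
    effDeg G (step G R L τ ρ σ) v ≤ ∑ u ∈ G.neighborFinset v ∩ σ.alive, newP G R L τ ρ σ u := by
  refine Finset.sum_le_sum_of_subset_of_nonneg (Finset.inter_subset_inter_left ?_)
    fun u _ _ => (newP_pos G (hp u)).le
  exact Finset.filter_subset _ _

lemma effDeg_step_le (hp : ∀ u, Dyadic b (σ.p u)) (v : V) :
    effDeg G (step G R L τ ρ σ) v ≤ 2 * effDeg G σ v := by
  refine (effDeg_step_le_sum G hp v).trans ?_
  rw [effDeg, Finset.mul_sum]
  exact Finset.sum_le_sum fun u _ => (newP_le G (hp u)).trans (min_le_left _ _)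

/-- A remaining neighbor that is not light either stalls or, in the absence of errors, has estimate
at least 2; both make it halve its probability. The light ones had total probability at most `2 /
8000`, and doubling instead of halving adds at most `3/2` times this. -/
lemma effDeg_step_le_of_not_golden (hp : ∀ u, Dyadic b (σ.p u)) {v : V}
    (herr : ¬ EstimateError G σ ρ v) (hg : ¬ Golden G R L τ ρ σ v) :
    effDeg G (step G R L τ ρ σ) v ≤ effDeg G σ v / 2 + 3 / 8000 := by
  classical
  set N := G.neighborFinset v ∩ σ.alive with hN
  set F := lightNodes G R L τ ρ σ v
  have hlight : ∑ u ∈ N.filter (· ∈ F), σ.p u ≤ 1 / 4000 := by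
    have h1 : ∑ u ∈ N.filter (· ∈ F), σ.p u ≤ ∑ u ∈ F, 2 * newP G R L τ ρ σ u := by
      calc _ ≤ ∑ u ∈ N.filter (· ∈ F), 2 * newP G R L τ ρ σ u :=
            Finset.sum_le_sum fun u _ => by
              linarith [half_le_newP G (R := R) (L := L) (τ := τ) (ρ := ρ) (hp u)]
        _ ≤ _ := Finset.sum_le_sum_of_subset_of_nonneg
            (fun u hu => (Finset.mem_filter.mp hu).2)
            fun u _ _ => by linarith [newP_pos G (R := R) (L := L) (τ := τ) (ρ := ρ) (hp u)]
    rw [← Finset.mul_sum] at h1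
    unfold Golden at hg
    linarith
  have hpt : ∀ u ∈ N, newP G R L τ ρ σ u ≤
      σ.p u / 2 + if u ∈ F then 3 / 2 * σ.p u else 0 := by
    intro u hu
    obtain ⟨hadj, halive⟩ := Finset.mem_inter.mp hu
    by_cases hF : u ∈ F
    · rw [if_pos hF]
      linarith [(newP_le G (R := R) (L := L) (τ := τ) (ρ := ρ) (hp u)).trans (min_le_left _ _)]
    · rw [if_neg hF, add_zero]
      refine (newP_of_halving G ?_).le
      by_contra hh
      push Not at hh
      refine hF ((mem_lightNodes G).mpr
        ⟨neighborFinset_subset_closedNbhd G v hadj, halive, hh.2, ?_⟩)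
      by_contra hd
      exact herr (Or.inr ⟨u, hadj, not_lt.mp hd, hh.1⟩)
  calc effDeg G (step G R L τ ρ σ) v ≤ ∑ u ∈ N, newP G R L τ ρ σ u := effDeg_step_le_sum G hp v
    _ ≤ ∑ u ∈ N, (σ.p u / 2 + if u ∈ F then 3 / 2 * σ.p u else 0) := Finset.sum_le_sum hpt
    _ = effDeg G σ v / 2 + 3 / 2 * ∑ u ∈ N.filter (· ∈ F), σ.p u := by
        rw [Finset.sum_add_distrib, ← Finset.sum_div, ← Finset.sum_filter, ← Finset.mul_sum]
        rfl
    _ ≤ _ := by linarith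

/-- This isolates what is needed of the nested phases: a stall continues, or one of some length `l`
starts after passing its test, or there is none. In the last case the supremum over the empty set is
0, which is never in the future. -/
lemma newStallEnd_cases (hR : 0 < R) (v : V) :
    (τ < σ.stallEnd v ∧ newStallEnd G R L τ ρ σ v = σ.stallEnd v) ∨
    (σ.stallEnd v ≤ τ ∧ ∃ l, 1 ≤ l ∧ newStallEnd G R L τ ρ σ v = τ + l ∧
      (2 : ℝ) ^ (2 * l) < estimate G ρ σ v) ∨
    (σ.stallEnd v ≤ τ ∧ newStallEnd G R L τ ρ σ v = 0) := by
  classical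
  by_cases h : τ < σ.stallEnd v
  · exact Or.inl ⟨h, by rw [newStallEnd, if_pos h]⟩
  rw [newStallEnd, if_neg h]
  right
  set S := (Finset.range (L + 1)).filter (fun i =>
      R * 2 ^ i ∣ τ ∧ (2 : ℝ) ^ (2 * (R * 2 ^ i)) < estimate G ρ σ v) with hS
  rcases S.eq_empty_or_nonempty with he | hne
  · right
    refine ⟨not_lt.mp h, ?_⟩
    rw [← Nat.bot_eq_zero, ← Finset.sup_empty (f := fun i => τ + R * 2 ^ i), ← he]
  · left
    refine ⟨not_lt.mp h, ?_⟩
    obtain ⟨i, hi, hsup⟩ := Finset.exists_mem_eq_sup S hne (fun i => τ + R * 2 ^ i)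
    refine ⟨R * 2 ^ i, Nat.mul_pos hR (by positivity), ?_, (Finset.mem_filter.mp hi).2.2⟩
    rw [← hsup]

/-- The potential whose decrease in iterations that are not golden bounds their number. -/
noncomputable def potential (τ : ℕ) (σ : State V) (v : V) : ℝ :=
  max (4 * degreeLevel (effDeg G σ v)) (2 * ((σ.stallEnd v - τ : ℕ) : ℝ)) - Real.logb 2 (σ.p v) - 1

/-- Since `-log p` grows by at most 1, a drop of the maximum by 2 suffices. The weight 4 turns a
drop of the level by `1/2` into 2, and the weight 2 does the same for one iteration of stalling. If
nothing is left to drop in the maximum, `p` doubles instead. -/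
lemma potential_step_le (hR : 0 < R) (hp : ∀ u, Dyadic b (σ.p u)) {v : V} (hv : v ∈ σ.alive)
    (herr : ¬ EstimateError G σ ρ v) :
    potential G (τ + 1) (step G R L τ ρ σ) v ≤
      potential G τ σ v - 1 + 10 * ind (Golden G R L τ ρ σ v) := by
  have hest : estimate G ρ σ v ≤ 100 * effDeg G σ v := not_lt.mp fun h => herr (Or.inl h)
  have hd2 := effDeg_step_le G (R := R) (L := L) (τ := τ) (ρ := ρ) hp v
  set d := effDeg G σ v with hd
  set d' := effDeg G (step G R L τ ρ σ) v with hd'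
  have hφ := degreeLevel_nonneg d
  have hlev2 := degreeLevel_le_add_two hd2
  have hppos := (hp v).pos
  have hlogp : -Real.logb 2 (newP G R L τ ρ σ v) ≤ -Real.logb 2 (σ.p v) + 1 := by
    rw [← neg_logb_half _ hppos]
    exact neg_le_neg (Real.logb_le_logb_of_le (by norm_num) (by linarith)
      (half_le_newP G (hp v)))
  simp only [potential, ← hd, ← hd']
  change max (4 * degreeLevel d') (2 * ((newStallEnd G R L τ ρ σ v - (τ + 1) : ℕ) : ℝ))
    - Real.logb 2 (newP G R L τ ρ σ v) - 1 ≤ _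
  -- A running stall loses one iteration, and a new stall is charged to the degree level; in both
  -- cases the stall term ends up 2 below the old maximum. Otherwise `v` is not stalling.
  have hstall : (2 * ((newStallEnd G R L τ ρ σ v - (τ + 1) : ℕ) : ℝ) ≤
      max (4 * degreeLevel d) (2 * ((σ.stallEnd v - τ : ℕ) : ℝ)) - 2) ∨
      ((newStallEnd G R L τ ρ σ v - (τ + 1) : ℕ) : ℝ) = 0 ∧ σ.stallEnd v ≤ τ ∧
        ¬ Stalling G R L τ ρ σ v := by
    rcases newStallEnd_cases G (R := R) (L := L) (τ := τ) (ρ := ρ) (σ := σ) hR v with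
      ⟨h1, h2⟩ | ⟨h1, l, hl, h2, h3⟩ | ⟨h1, h2⟩
    · left
      rw [h2]
      refine le_trans ?_ (sub_le_sub_right (le_max_right _ _) 2)
      have : σ.stallEnd v - τ = (σ.stallEnd v - (τ + 1)) + 1 := by omega
      rw [this]; push_cast; linarith
    · left
      rw [h2]
      refine le_trans ?_ (sub_le_sub_right (le_max_left _ _) 2)
      have := (two_mul_le_degreeLevel (h3.trans_le hest)).2
      have hl' : τ + l - (τ + 1) = l - 1 := by omega
      rw [hl', Nat.cast_sub hl]; push_cast; linarith
    · right
      refine ⟨by rw [h2]; simp, h1, ?_⟩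
      rw [Stalling, h2]; omega
  have hs0 : (0 : ℝ) ≤ 2 * ((σ.stallEnd v - τ : ℕ) : ℝ) := by positivity
  have hmax := le_max_left (4 * degreeLevel d) (2 * ((σ.stallEnd v - τ : ℕ) : ℝ))
  -- In a golden iteration the level rises by at most 2, hence the maximum by at most 8, and `-log
  -- p` by at most 1: in total `9 = 10 - 1`.
  by_cases hg : Golden G R L τ ρ σ v
  · rw [ind_of hg]
    have : max (4 * degreeLevel d') (2 * ((newStallEnd G R L τ ρ σ v - (τ + 1) : ℕ) : ℝ)) ≤
        max (4 * degreeLevel d) (2 * ((σ.stallEnd v - τ : ℕ) : ℝ)) + 8 := by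
      refine max_le (by linarith) ?_
      rcases hstall with h | ⟨h, _⟩
      · linarith
      · rw [h]; linarith
    linarith
  rw [ind_of_not hg]
  have hdng := effDeg_step_le_of_not_golden G hp herr hg
  rw [← hd, ← hd'] at hdng
  rcases le_or_gt (1 / 200) d with hhigh | hlow
  -- The additive term `3/8000` is at most `3/20 * d` because `d ≥ 1/200`.
  · have hdrop := degreeLevel_le_sub_half hhigh (by linarith : d' ≤ 13 / 20 * d)
    have h1 := one_le_degreeLevel hhigh
    have : max (4 * degreeLevel d') (2 * ((newStallEnd G R L τ ρ σ v - (τ + 1) : ℕ) : ℝ)) ≤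
        max (4 * degreeLevel d) (2 * ((σ.stallEnd v - τ : ℕ) : ℝ)) - 2 := by
      refine max_le (by linarith) ?_
      rcases hstall with h | ⟨h, _⟩
      · exact h
      · rw [h]; linarith
    linarith
  · have hφ' : degreeLevel d' = 0 := by
      refine degreeLevel_of_lt ?_
      rcases le_or_gt (1 / 400) d with h | h <;> linarith
    have hφ0 := degreeLevel_of_lt hlow
    rw [hφ', hφ0, mul_zero, max_eq_right hs0, max_eq_right (by positivity)]
    rw [hφ0, mul_zero, max_eq_right hs0] at hstall
    rcases hstall with h | ⟨h, hend, hns⟩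
    · linarith
    -- The estimate is at most `100 * d < 1/2`, so `v` raises its probability.
    · have hnh : ¬ (2 ≤ estimate G ρ σ v ∨ Stalling G R L τ ρ σ v) := by
        rintro (h2 | h2)
        · linarith
        · exact hns h2
      have hnew := newP_of_not_halving G hnh
      -- Here `v` itself is a light node, so a larger value would make the iteration golden.
      -- Consequently the cap `1/2` is inactive and `p` really doubles.
      have hsmall : newP G R L τ ρ σ v < 1 / 8000 := by
        by_contra hge
        refine hg ((not_lt.mp hge).trans ?_)
        refine Finset.single_le_sum (f := newP G R L τ ρ σ)
          (fun u _ => (newP_pos G (hp u)).le) ((mem_lightNodes G).mpr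
            ⟨self_mem_closedNbhd G v, hv, hns, ?_⟩)
        linarith
      have hmin : newP G R L τ ρ σ v = 2 * σ.p v := by
        rw [hnew] at hsmall ⊢
        refine min_eq_left (le_of_lt ?_)
        by_contra hle
        rw [min_eq_right (not_lt.mp hle)] at hsmall
        norm_num at hsmall
      have := neg_logb_two_mul _ hppos
      rw [h, hmin]
      linarith

lemma potential_nonneg {v : V} (hp : Dyadic b (σ.p v)) : 0 ≤ potential G τ σ v := by
  have h1 : Real.logb 2 (σ.p v) ≤ Real.logb 2 (2⁻¹) :=
    Real.logb_le_logb_of_le (by norm_num) hp.pos (by linarith [hp.le_half])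
  rw [Real.logb_inv, Real.logb_self_eq_one (by norm_num)] at h1
  have h2 : 0 ≤ 4 * degreeLevel (effDeg G σ v) := by linarith [degreeLevel_nonneg (effDeg G σ v)]
  have := h2.trans (le_max_left _ (2 * ((σ.stallEnd v - τ : ℕ) : ℝ)))
  rw [potential]
  linarith

end Step

end RecursiveMIS

/-! ### The success probability in a golden iteration, and the weight of an iteration. -/

namespace RecursiveMIS

/-- For independent events of probabilities `P u`, this decomposes the event that at least one
occurs according to the first one in the order given by `r`. -/
lemma sum_mul_prod_filter_lt {κ : Type*} [DecidableEq κ] (r : κ → ℕ) (hr : Function.Injective r)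
    (P : κ → ℝ) (S : Finset κ) :
    ∑ u ∈ S, P u * ∏ w ∈ S.filter (fun w => r w < r u), (1 - P w) = 1 - ∏ u ∈ S, (1 - P u) := by
  induction S using Finset.induction_on_max_value r with
  | empty => simp
  | insert a S ha hmax ih =>
    rw [Finset.sum_insert ha, Finset.prod_insert ha]
    have h1 : (insert a S).filter (fun w => r w < r a) = S := by
      ext w
      simp only [Finset.mem_filter, Finset.mem_insert]
      refine ⟨?_, fun hw => ⟨Or.inr hw, (hmax w hw).lt_of_ne fun h => ha (hr h ▸ hw)⟩⟩
      rintro ⟨rfl | hw, hlt⟩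
      · exact absurd hlt (lt_irrefl _)
      · exact hw
    have h2 : ∀ u ∈ S, (insert a S).filter (fun w => r w < r u)
        = S.filter (fun w => r w < r u) := by
      intro u hu
      rw [Finset.filter_insert, if_neg (not_lt.mpr (hmax u hu))]
    rw [h1, Finset.sum_congr rfl fun u hu => by rw [h2 u hu], ih]
    ring

lemma exp_neg_two_mul_le {q : ℝ} (h0 : 0 ≤ q) (h1 : q ≤ 1 / 2) : Real.exp (-(2 * q)) ≤ 1 - q := by
  rw [Real.exp_neg, inv_le_comm₀ (Real.exp_pos _) (by linarith)]
  refine le_trans ?_ (Real.add_one_le_exp (2 * q))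
  rw [inv_le_iff_one_le_mul₀ (by linarith)]
  nlinarith

/-- A lower bound for the success probability in a golden iteration. -/
noncomputable def hitProb : ℝ := Real.exp (-48) * (1 - Real.exp (-(1 / 8000)))

lemma hitProb_pos : 0 < hitProb :=
  mul_pos (Real.exp_pos _) (sub_pos.mpr (by simp))

lemma hitProb_le_half : hitProb ≤ 1 / 2 := by
  have h1 : Real.exp (-48) ≤ 1 / 2 := by
    rw [Real.exp_neg, inv_le_comm₀ (Real.exp_pos _) (by norm_num)]
    linarith [Real.add_one_le_exp (48 : ℝ)]
  have h2 : 1 - Real.exp (-(1 / 8000)) ≤ 1 := by linarith [Real.exp_pos (-(1 / 8000))]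
  have h3 : 0 ≤ 1 - Real.exp (-(1 / 8000)) :=
    (sub_pos.mpr (by simp)).le
  calc hitProb ≤ 1 / 2 * 1 := mul_le_mul h1 h2 h3 (by norm_num)
    _ = 1 / 2 := mul_one _

section Success

variable {V : Type*} [Fintype V] [DecidableEq V] (G : SimpleGraph V) [DecidableRel G.Adj]
variable {k b : ℕ} (R L τ : ℕ) (ρ : V → IterCoins k b) (σ : State V)

/-- A node of the closed neighborhood of `v` marks itself, and no neighbor of it can, whatever the
estimates of these neighbors are. -/
def Success (v : V) : Prop :=
  ∃ u ∈ closedNbhd G v, u ∈ σ.alive ∧ ¬ Stalling G R L τ ρ σ u ∧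
    (ρ u).2.val < newP G R L τ ρ σ u ∧
    ∀ w ∈ G.neighborFinset u ∩ σ.alive, ¬ (ρ w).2.val < min (2 * σ.p w) (1 / 2)

variable {R L τ ρ σ}

lemma notMem_alive_of_success (hp : ∀ u, Dyadic b (σ.p u)) {v : V}
    (h : Success G R L τ ρ σ v) : v ∉ (step G R L τ ρ σ).alive := by
  obtain ⟨u, hu, halive, hns, hmark, hclear⟩ := h
  have hjoin : u ∈ joining G R L τ ρ σ := by
    simp only [joining, Finset.mem_filter, Finset.mem_univ, true_and]
    refine ⟨⟨halive, hns, hmark⟩, fun w hw hm => ?_⟩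
    refine hclear w (Finset.mem_inter.mpr ⟨(G.mem_neighborFinset u w).mpr hw, hm.1⟩) ?_
    exact hm.2.2.trans_le (newP_le G (hp w))
  intro hv
  simp only [step, Finset.mem_filter] at hv
  rcases Finset.mem_insert.mp hu with rfl | hu
  · exact hv.2.1 hjoin
  · exact hv.2.2 u ((G.mem_neighborFinset v u).mp hu) hjoin

section Coins

variable {T : ℕ} {t : Fin T}

/-- The coordinates of the marking of the nodes of `W` in iteration `t`. -/
def markBlock (t : Fin T) (W : Finset V) : Finset (CoinIndex V T k) := {t} ×ˢ W ×ˢ {none}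

/-- The coordinates of the nodes of `W` in iteration `t`. -/
def coinBlock (t : Fin T) (W : Finset V) : Finset (CoinIndex V T k) :=
  {t} ×ˢ W ×ˢ Finset.univ

lemma mem_markBlock {W : Finset V} {i : CoinIndex V T k} :
    i ∈ markBlock t W ↔ i.1 = t ∧ i.2.1 ∈ W ∧ i.2.2 = none := by
  simp only [markBlock, Finset.mem_product, Finset.mem_singleton]

lemma mem_coinBlock {W : Finset V} {i : CoinIndex V T k} :
    i ∈ coinBlock t W ↔ i.1 = t ∧ i.2.1 ∈ W := by
  simp only [coinBlock, Finset.mem_product, Finset.mem_singleton, Finset.mem_univ, and_true]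

lemma disjoint_sampleBlock_markBlock (W : Finset V) :
    Disjoint (sampleBlock (k := k) t W) (markBlock t W) := by
  refine Finset.disjoint_left.mpr fun i hi hi' => ?_
  obtain ⟨_, _, j, hj⟩ := mem_sampleBlock.mp hi
  rw [(mem_markBlock.mp hi').2.2] at hj
  exact Option.some_ne_none j hj.symm

lemma sampleBlock_union_markBlock (W : Finset V) :
    sampleBlock (k := k) t W ∪ markBlock t W = coinBlock t W := by
  ext ⟨t', u, o⟩
  rw [Finset.mem_union, mem_sampleBlock, mem_markBlock, mem_coinBlock]
  cases o <;> simp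

lemma notMem_markBlock_of_mem_sampleBlock {W : Finset V} {i : CoinIndex V T k}
    (hi : i ∈ sampleBlock t W) (W' : Finset V) : i ∉ markBlock t W' := by
  intro hi'
  obtain ⟨_, _, j, hj⟩ := mem_sampleBlock.mp hi
  rw [(mem_markBlock.mp hi').2.2] at hj
  exact Option.some_ne_none j hj.symm

section Congr

variable {v : V} {x y : CoinIndex V T k → Number b}
  (h : ∀ i ∈ sampleBlock t (closedNbhd₂ G v), x i = y i)
include h

lemma newStallEnd_congr {u : V} (hu : u ∈ closedNbhd G v) :
    newStallEnd G R L τ (coinsAt t x) σ u = newStallEnd G R L τ (coinsAt t y) σ u := by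
  have := estimate_congr G (σ := σ) (neighborFinset_subset_closedNbhd₂ G hu) h
  simp only [newStallEnd, this]

lemma stalling_congr {u : V} (hu : u ∈ closedNbhd G v) :
    Stalling G R L τ (coinsAt t x) σ u ↔ Stalling G R L τ (coinsAt t y) σ u := by
  rw [Stalling, Stalling, newStallEnd_congr G h hu]

lemma newP_congr {u : V} (hu : u ∈ closedNbhd G v) :
    newP G R L τ (coinsAt t x) σ u = newP G R L τ (coinsAt t y) σ u := by
  have := estimate_congr G (σ := σ) (neighborFinset_subset_closedNbhd₂ G hu) h
  have hiff : (2 ≤ estimate G (coinsAt t x) σ u ∨ Stalling G R L τ (coinsAt t x) σ u) ↔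
      (2 ≤ estimate G (coinsAt t y) σ u ∨ Stalling G R L τ (coinsAt t y) σ u) := by
    rw [this, stalling_congr G h hu]
  by_cases hx : 2 ≤ estimate G (coinsAt t x) σ u ∨ Stalling G R L τ (coinsAt t x) σ u
  · rw [newP_of_halving G hx, newP_of_halving G (hiff.mp hx)]
  · rw [newP_of_not_halving G hx, newP_of_not_halving G (hiff.not.mp hx)]

lemma lightNodes_congr :
    lightNodes G R L τ (coinsAt t x) σ v = lightNodes G R L τ (coinsAt t y) σ v := by
  ext u
  rw [mem_lightNodes, mem_lightNodes]
  refine and_congr_right fun hu => ?_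
  rw [stalling_congr G h hu]

/-- Goldenness reads sampling coins only, so the marking coins of the same iteration remain uniform
once it is known. -/
lemma golden_congr :
    Golden G R L τ (coinsAt t x) σ v ↔ Golden G R L τ (coinsAt t y) σ v := by
  rw [Golden, Golden, lightNodes_congr G h]
  rw [Finset.sum_congr rfl fun u hu => newP_congr G h ((mem_lightNodes G).mp hu).1]

end Congr

lemma success_congr {v : V} {x y : CoinIndex V T k → Number b}
    (h : ∀ i ∈ coinBlock t (closedNbhd₂ G v), x i = y i) :
    Success G R L τ (coinsAt t x) σ v ↔ Success G R L τ (coinsAt t y) σ v := by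
  have hs : ∀ i ∈ sampleBlock t (closedNbhd₂ G v), x i = y i := fun i hi => h i <| by
    rw [← sampleBlock_union_markBlock]; exact Finset.mem_union_left _ hi
  have hm : ∀ w ∈ closedNbhd₂ G v, (coinsAt t x w).2 = (coinsAt t y w).2 := fun w hw =>
    h (t, w, none) (mem_coinBlock.mpr ⟨rfl, hw⟩)
  unfold Success
  refine exists_congr fun u => and_congr_right fun hu => and_congr_right fun _ => ?_
  rw [stalling_congr G hs hu, newP_congr G hs hu,
    hm u (closedNbhd_subset_closedNbhd₂ G hu (self_mem_closedNbhd G u))]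
  refine and_congr_right fun _ => and_congr_right fun _ => forall₂_congr fun w hw => ?_
  rw [hm w (neighborFinset_subset_closedNbhd₂ G hu (Finset.inter_subset_left hw))]

/-- With the samples fixed, success contains the disjoint union over light nodes `u` of the event
that `u` is the first light node whose marking number is below its probability while all remaining
neighbors of `u` are above their caps. The caps cost a factor `exp (-48)`, and the first-node
probabilities sum to `1 - ∏ (1 - P u)`. -/
lemma avg_not_success_le (hp : ∀ u, Dyadic b (σ.p u)) {v : V}
    {x : CoinIndex V T k → Number b}
    (hnew : ∀ u, Dyadic b (newP G R L τ (coinsAt t x) σ u))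
    (hg : Golden G R L τ (coinsAt t x) σ v) :
    avg (markBlock t (closedNbhd₂ G v))
      (fun z => ind (¬ Success G R L τ (coinsAt t z) σ v)) x ≤ 1 - hitProb := by
  set W := closedNbhd₂ G v
  set F := lightNodes G R L τ (coinsAt t x) σ v
  set P := newP G R L τ (coinsAt t x) σ
  -- An upper bound for the new probability whatever the samples are. Using it for neighbors of `u`
  -- avoids their estimates, which may depend on nodes at distance three from `v`.
  set q : V → ℝ := fun w => min (2 * σ.p w) (1 / 2) with hq
  let r : V → ℕ := fun u => (Fintype.equivFin V u : ℕ)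
  have hr : Function.Injective r :=
    Fin.val_injective.comp (Fintype.equivFin V).injective
  have hqd : ∀ u, Dyadic b (q u) := by
    intro u
    obtain ⟨j, hj1, hjb, hj⟩ := hp u
    rcases Nat.lt_or_ge j 2 with h | h
    · obtain rfl : j = 1 := by omega
      exact ⟨1, le_rfl, hjb, by simp only [hq, hj]; norm_num⟩
    · refine ⟨j - 1, by omega, by omega, ?_⟩
      have h2 : 2 * σ.p u = (1 / 2) ^ (j - 1) := by
        rw [hj]
        conv_lhs => rw [show j = (j - 1) + 1 by omega, pow_succ]
        ring
      have h3 : ((1 : ℝ) / 2) ^ (j - 1) ≤ 1 / 2 := by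
        simpa using pow_le_pow_of_le_one (by norm_num : (0 : ℝ) ≤ 1 / 2) (by norm_num)
          (show 1 ≤ j - 1 by omega)
      simp only [hq, h2]
      exact min_eq_left h3
  have hPq : ∀ u, P u ≤ q u := fun u => newP_le G (hp u)
  have hFnb : ∀ u ∈ F, u ∈ closedNbhd G v := fun u hu => ((mem_lightNodes G).mp hu).1
  let N : V → Finset V := fun u => G.neighborFinset u ∩ σ.alive
  let B : V → Finset V := fun u => F.filter fun w => r w < r u
  -- The condition that the event `E u` imposes on the marking number of `w`. As `E u` is a
  -- conjunction over single coordinates, its probability is a product.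
  let c : V → V → Number b → Prop := fun u w a =>
    (w = u → a.val < P u) ∧ (w ∈ N u → ¬ a.val < q w) ∧ (w ∈ B u → ¬ a.val < P w)
  let E : V → (CoinIndex V T k → Number b) → Prop := fun u z => ∀ w ∈ W, c u w (z (t, w, none))
  have hFW : ∀ u ∈ F, u ∈ W := fun u hu =>
    closedNbhd_subset_closedNbhd₂ G (hFnb u hu) (self_mem_closedNbhd G u)
  have hNW : ∀ u ∈ F, N u ⊆ W := fun u hu =>
    Finset.inter_subset_left.trans (neighborFinset_subset_closedNbhd₂ G (hFnb u hu))
  have hBW : ∀ u, B u ⊆ W := fun u w hw => hFW w (Finset.mem_filter.mp hw).1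
  have hprob : ∀ u ∈ F, Real.exp (-48) * (P u * ∏ w ∈ B u, (1 - P w)) ≤
      avg (markBlock t W) (fun z => ind (E u z)) x := by
    intro u hu
    let m : V → ℝ := fun w =>
      if w = u then P u else if w ∈ N u then 1 - q w else if w ∈ B u then 1 - P w else 1
    have havg : avg (markBlock t W) (fun z => ind (E u z)) x = ∏ w ∈ W, m w := by
      simp only [E, ind_forall_mem]
      refine avg_prod_eq W (fun w => {(t, w, none)}) _ m ?_ x _ ?_ ?_ ?_
      · intro w _ w' _ hne
        simpa using hne
      · intro w hw
        simpa using mem_markBlock.mpr ⟨rfl, hw, rfl⟩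
      · intro w _ z z' hz
        rw [hz _ (Or.inl (Finset.mem_singleton_self _))]
      · intro w _ z _
        have hnot : ∀ {s : ℝ}, Dyadic b s → avg {((t, w, none) : CoinIndex V T k)}
            (fun z => ind (¬ (z (t, w, none)).val < s)) z = 1 - s := by
          intro s hs
          simp only [ind_not]
          rw [avg_sub, avg_const, avg_ind_val_lt hs (Finset.mem_singleton_self _)]
        by_cases h1 : w = u
        · subst h1
          have hN : w ∉ N w := fun h => G.irrefl
            ((G.mem_neighborFinset w w).mp (Finset.inter_subset_left h))
          have hB : w ∉ B w := fun h => lt_irrefl _ (Finset.mem_filter.mp h).2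
          simp only [m, c, if_true, hN, hB, false_imp_iff, and_true, true_imp_iff]
          exact avg_ind_val_lt (hnew w) (Finset.mem_singleton_self _) z
        by_cases h2 : w ∈ N u
        · simp only [m, if_neg h1, if_pos h2]
          rw [← hnot (hqd w)]
          refine avg_congr fun z _ => ind_congr ?_
          simp only [c, h1, h2, false_imp_iff, true_imp_iff, true_and]
          exact and_iff_left_of_imp fun h _ h' => h (h'.trans_le (hPq w))
        by_cases h3 : w ∈ B u
        · simp only [m, if_neg h1, if_neg h2, if_pos h3]
          rw [← hnot (hnew w)]
          refine avg_congr fun z _ => ind_congr ?_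
          simp only [c, h1, h2, h3, false_imp_iff, true_imp_iff, true_and]
        · simp only [m, if_neg h1, if_neg h2, if_neg h3]
          rw [← avg_const (α := Number b) {((t, w, none) : CoinIndex V T k)} 1 z]
          refine avg_congr fun z _ => ?_
          simp only [c, h1, h2, h3, false_imp_iff, true_and]
          exact ind_of trivial
    rw [havg]
    -- A node that is both a neighbor of `u` and an earlier light node faces only the stronger
    -- condition `1 - q w`; the extra factor `1 - P w` on the left only decreases the product.
    have hm : ∀ w ∈ W, (if w ∈ ({u} : Finset V) then P w else 1) *
        ((if w ∈ N u then 1 - q w else 1) * (if w ∈ B u then 1 - P w else 1)) ≤ m w := by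
      intro w _
      have h1 := (hqd w).le_half
      have h2 := (hnew w).le_half
      have h3 := (hqd w).pos
      have h4 := (hnew w).pos
      change P w ≤ 1 / 2 at h2
      change 0 < P w at h4
      by_cases hwu : w = u
      · subst hwu
        have hN : w ∉ N w := fun h => G.irrefl
          ((G.mem_neighborFinset w w).mp (Finset.inter_subset_left h))
        have hB : w ∉ B w := fun h => lt_irrefl _ (Finset.mem_filter.mp h).2
        simp [m, hN, hB]
      · simp only [m, Finset.mem_singleton, if_neg hwu, one_mul]
        split_ifs <;> nlinarith
    have hnn : ∀ w ∈ W, 0 ≤ (if w ∈ ({u} : Finset V) then P w else 1) *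
        ((if w ∈ N u then 1 - q w else 1) * (if w ∈ B u then 1 - P w else 1)) := by
      intro w _
      have h1 := (hqd w).le_half
      have h2 : P w ≤ 1 / 2 := (hnew w).le_half
      have h4 : 0 < P w := (hnew w).pos
      refine mul_nonneg ?_ (mul_nonneg ?_ ?_) <;> split_ifs <;> linarith
    refine le_trans ?_ (Finset.prod_le_prod hnn hm)
    rw [Finset.prod_mul_distrib, Finset.prod_mul_distrib, Finset.prod_ite_mem,
      Finset.prod_ite_mem, Finset.prod_ite_mem,
      Finset.inter_eq_right.mpr (Finset.singleton_subset_iff.mpr (hFW u hu)),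
      Finset.inter_eq_right.mpr (hNW u hu), Finset.inter_eq_right.mpr (hBW u),
      Finset.prod_singleton]
    -- Lightness gives `∑ q ≤ 2 * 12`, and `1 - q ≥ exp (-2 q)` doubles this once more.
    have hκ : Real.exp (-48) ≤ ∏ w ∈ N u, (1 - q w) := by
      have hsum : ∑ w ∈ N u, q w ≤ 2 * effDeg G σ u := by
        rw [effDeg, Finset.mul_sum]
        exact Finset.sum_le_sum fun w _ => min_le_left _ _
      have hlt := ((mem_lightNodes G).mp hu).2.2.2
      calc Real.exp (-48) ≤ Real.exp (∑ w ∈ N u, -(2 * q w)) := by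
            rw [Finset.sum_neg_distrib, ← Finset.mul_sum]
            exact Real.exp_le_exp.mpr (by linarith)
        _ = ∏ w ∈ N u, Real.exp (-(2 * q w)) := Real.exp_sum _ _
        _ ≤ _ := Finset.prod_le_prod (fun _ _ => (Real.exp_pos _).le) fun w _ =>
            exp_neg_two_mul_le (hqd w).pos.le (hqd w).le_half
    have hB0 : 0 ≤ P u * ∏ w ∈ B u, (1 - P w) := by
      refine mul_nonneg (hnew u).pos.le (Finset.prod_nonneg fun w _ => ?_)
      have : P w ≤ 1 / 2 := (hnew w).le_half
      linarith
    calc _ ≤ (∏ w ∈ N u, (1 - q w)) * (P u * ∏ w ∈ B u, (1 - P w)) :=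
          mul_le_mul_of_nonneg_right hκ hB0
      _ = _ := by ring
  have hsucc : ∀ z, (∀ i, i ∉ markBlock t W → z i = x i) →
      ∑ u ∈ F, ind (E u z) ≤ ind (Success G R L τ (coinsAt t z) σ v) := by
    intro z hz
    have hzx : ∀ i ∈ sampleBlock t (closedNbhd₂ G v), z i = x i := fun i hi =>
      hz i (notMem_markBlock_of_mem_sampleBlock hi _)
    refine sum_ind_le (fun u hu hE => ?_) fun u hu u' hu' hE hE' => ?_
    · obtain ⟨hunb, hal, hns, _⟩ := (mem_lightNodes G).mp hu
      refine ⟨u, hunb, hal, ?_, ?_, fun w hw => ?_⟩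
      · rwa [stalling_congr G hzx hunb]
      · rw [newP_congr G hzx hunb]
        exact (hE u (hFW u hu)).1 rfl
      · exact (hE w (hNW u hu hw)).2.1 hw
    · by_contra hne
      rcases lt_or_gt_of_ne (fun h => hne (hr h) : r u ≠ r u') with h | h
      · exact (hE' u (hFW u hu)).2.2 (Finset.mem_filter.mpr ⟨hu, h⟩) ((hE u (hFW u hu)).1 rfl)
      · exact (hE u' (hFW u' hu')).2.2 (Finset.mem_filter.mpr ⟨hu', h⟩)
          ((hE' u' (hFW u' hu')).1 rfl)
  have hmain : hitProb ≤ avg (markBlock t W)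
      (fun z => ind (Success G R L τ (coinsAt t z) σ v)) x := by
    calc hitProb ≤ Real.exp (-48) * (1 - ∏ u ∈ F, (1 - P u)) := by
          refine mul_le_mul_of_nonneg_left ?_ (Real.exp_pos _).le
          have hprod : ∏ u ∈ F, (1 - P u) ≤ Real.exp (-(1 / 8000)) := by
            calc ∏ u ∈ F, (1 - P u) ≤ ∏ u ∈ F, Real.exp (-P u) := by
                  refine Finset.prod_le_prod (fun u _ => ?_) fun u _ => ?_
                  · have : P u ≤ 1 / 2 := (hnew u).le_half
                    linarith
                  · linarith [Real.add_one_le_exp (-P u)]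
              _ = Real.exp (-∑ u ∈ F, P u) := by
                  rw [← Real.exp_sum, Finset.sum_neg_distrib]
              _ ≤ _ := Real.exp_le_exp.mpr (neg_le_neg hg)
          linarith
      _ = ∑ u ∈ F, Real.exp (-48) * (P u * ∏ w ∈ B u, (1 - P w)) := by
          rw [← Finset.mul_sum, sum_mul_prod_filter_lt r hr]
      _ ≤ ∑ u ∈ F, avg (markBlock t W) (fun z => ind (E u z)) x := Finset.sum_le_sum hprob
      _ = avg (markBlock t W) (fun z => ∑ u ∈ F, ind (E u z)) x := (avg_sum _ _ _ _).symm
      _ ≤ _ := avg_mono hsucc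
  simp only [ind_not]
  rw [avg_sub, avg_const]
  linarith

end Coins

variable (R L τ ρ σ)

/-- The factor by which iteration `τ` multiplies the weight of the event that `v` survives. -/
noncomputable def stepWeight (M : ℝ) (v : V) : ℝ :=
  (1 + M * ind (EstimateError G σ ρ v)) *
    ((1 + ((1 - hitProb)⁻¹ - 1) * ind (Golden G R L τ ρ σ v)) * ind (¬ Success G R L τ ρ σ v))

variable {R L τ ρ σ}

lemma one_le_inv_one_sub_hitProb : 1 ≤ (1 - hitProb)⁻¹ :=
  (one_le_inv₀ (by linarith [hitProb_le_half])).mpr (by linarith [hitProb_pos])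

lemma stepWeight_nonneg {M : ℝ} (hM : 0 ≤ M) (v : V) : 0 ≤ stepWeight G R L τ ρ σ M v := by
  have h1 := one_le_inv_one_sub_hitProb
  have h2 := ind_nonneg (EstimateError G σ ρ v)
  have h3 := ind_nonneg (Golden G R L τ ρ σ v)
  have h4 := ind_nonneg (¬ Success G R L τ ρ σ v)
  have h5 := mul_nonneg (sub_nonneg.mpr h1) h3
  unfold stepWeight
  positivity

lemma stepWeight_congr {T : ℕ} {t : Fin T} {M : ℝ} {v : V} {x y : CoinIndex V T k → Number b}
    (h : ∀ i ∈ coinBlock t (closedNbhd₂ G v), x i = y i) :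
    stepWeight G R L τ (coinsAt t x) σ M v = stepWeight G R L τ (coinsAt t y) σ M v := by
  have hs : ∀ i ∈ sampleBlock t (closedNbhd₂ G v), x i = y i := fun i hi => h i <| by
    rw [← sampleBlock_union_markBlock]; exact Finset.mem_union_left _ hi
  rw [stepWeight, stepWeight, ind_congr (estimateError_congr G hs), ind_congr (golden_congr G hs),
    ind_congr (not_congr (success_congr G h))]

/-- Errors and goldenness are fixed by the samples. Averaging over the markings first, the golden
factor `(1 - hitProb)⁻¹` cancels the probability `1 - hitProb` of no success, and only the error
factor is left for the average over the samples. -/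
lemma avg_stepWeight_le {T : ℕ} {t : Fin T} {M : ℝ} (hM : 0 ≤ M) (hp : ∀ u, Dyadic b (σ.p u))
    (hnew : ∀ (ρ : V → IterCoins k b) u, Dyadic b (newP G R L τ ρ σ u)) (v : V)
    (x : CoinIndex V T k → Number b) :
    avg (coinBlock t (closedNbhd₂ G v))
      (fun z => stepWeight G R L τ (coinsAt t z) σ M v) x
      ≤ 1 + M * ((G.maxDegree + 1) * (1 / 5) ^ k) := by
  rw [← sampleBlock_union_markBlock, avg_union (disjoint_sampleBlock_markBlock _)]
  calc _ ≤ avg (sampleBlock t (closedNbhd₂ G v))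
        (fun z => 1 + M * ind (EstimateError G σ (coinsAt t z) v)) x := by
        refine avg_mono fun z _ => ?_
        have hinner : avg (markBlock t (closedNbhd₂ G v)) (fun z =>
            (1 + ((1 - hitProb)⁻¹ - 1) * ind (Golden G R L τ (coinsAt t z) σ v)) *
              ind (¬ Success G R L τ (coinsAt t z) σ v)) z ≤ 1 := by
          rw [avg_mul_left (g := fun z =>
            1 + ((1 - hitProb)⁻¹ - 1) * ind (Golden G R L τ (coinsAt t z) σ v))]
          · by_cases hg : Golden G R L τ (coinsAt t z) σ v
            · have := avg_not_success_le G hp (hnew _) hg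
              rw [ind_of hg, mul_one, add_sub_cancel, inv_mul_le_one₀]
              · exact this
              · linarith [hitProb_le_half]
            · rw [ind_of_not hg, mul_zero, add_zero, one_mul]
              exact avg_le_of_forall_le fun _ _ => ind_le_one _
          · intro z' hz'
            rw [ind_congr (golden_congr G fun i hi =>
              hz' i (notMem_markBlock_of_mem_sampleBlock hi _))]
        have hE0 : 0 ≤ 1 + M * ind (EstimateError G σ (coinsAt t z) v) := by
          have := ind_nonneg (EstimateError G σ (coinsAt t z) v)
          positivity
        calc _ = (1 + M * ind (EstimateError G σ (coinsAt t z) v)) * _ := by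
              unfold stepWeight
              refine avg_mul_left
                (g := fun z => 1 + M * ind (EstimateError G σ (coinsAt t z) v)) fun z' hz' => ?_
              rw [ind_congr (estimateError_congr G fun i hi =>
                hz' i (notMem_markBlock_of_mem_sampleBlock hi _))]
          _ ≤ _ := mul_le_of_le_one_right hE0 hinner
    _ = 1 + M * avg (sampleBlock t (closedNbhd₂ G v))
          (fun z => ind (EstimateError G σ (coinsAt t z) v)) x := by
        rw [avg_add, avg_const, avg_const_mul]
    _ ≤ _ := by
        gcongr
        exact avg_estimateError_le G hp v t x

end Success

end RecursiveMIS

/-! ### The whole execution: weights along a run and the survival probability. -/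

namespace RecursiveMIS

section Execution

variable {V : Type*} [Fintype V] [DecidableEq V] (G : SimpleGraph V) [DecidableRel G.Adj]
variable {k b : ℕ} (R L : ℕ)

/-- The coins of an execution, from the family of all random numbers. -/
def toCoins {T : ℕ} (x : CoinIndex V T k → Number b) : Coins V T k b := fun v t => coinsAt t x v

/-- The state after `t` iterations as a function of the family of all random numbers. -/
noncomputable def runState (t : ℕ) (x : CoinIndex V (R * 2 ^ L) k → Number b) : State V :=
  stateAt G R L (toCoins x) t

lemma runState_zero (x : CoinIndex V (R * 2 ^ L) k → Number b) :
    runState G R L 0 x = initState V := rfl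

lemma runState_succ (t : Fin (R * 2 ^ L)) (x : CoinIndex V (R * 2 ^ L) k → Number b) :
    runState G R L (t + 1) x = step G R L t (coinsAt t x) (runState G R L t x) := by
  rw [runState, stateAt, dif_pos t.2]
  rfl

lemma runState_congr {t : ℕ} (ht : t ≤ R * 2 ^ L) {x y : CoinIndex V (R * 2 ^ L) k → Number b}
    (h : ∀ i : CoinIndex V (R * 2 ^ L) k, (i.1 : ℕ) < t → x i = y i) :
    runState G R L t x = runState G R L t y := by
  induction t with
  | zero => rfl
  | succ t ih =>
    have hx := runState_succ G R L ⟨t, ht⟩ x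
    have hy := runState_succ G R L ⟨t, ht⟩ y
    simp only at hx hy
    rw [hx, hy, ih (by omega) fun i hi => h i (by omega)]
    congr 1
    funext v
    simp only [coinsAt]
    rw [h (⟨t, ht⟩, v, none) (Nat.lt_succ_self t)]
    congr 1
    funext j
    rw [h (⟨t, ht⟩, v, some j) (Nat.lt_succ_self t)]

lemma newP_eq_pow {τ j : ℕ} {ρ : V → IterCoins k b} {σ : State V} {u : V} (hj : 1 ≤ j)
    (hp : σ.p u = (1 / 2) ^ j) :
    ∃ j', 1 ≤ j' ∧ j' ≤ j + 1 ∧ newP G R L τ ρ σ u = (1 / 2) ^ j' := by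
  by_cases h : 2 ≤ estimate G ρ σ u ∨ Stalling G R L τ ρ σ u
  · exact ⟨j + 1, by omega, le_rfl, by rw [newP_of_halving G h, hp, pow_succ]; ring⟩
  · rw [newP_of_not_halving G h, hp]
    rcases Nat.lt_or_ge j 2 with h2 | h2
    · obtain rfl : j = 1 := by omega
      exact ⟨1, le_rfl, by omega, by norm_num⟩
    · refine ⟨j - 1, by omega, by omega, ?_⟩
      have h3 : (2 : ℝ) * (1 / 2) ^ j = (1 / 2) ^ (j - 1) := by
        conv_lhs => rw [show j = (j - 1) + 1 by omega, pow_succ]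
        ring
      rw [h3]
      have h4 := pow_le_pow_of_le_one (by norm_num : (0 : ℝ) ≤ 1 / 2) (by norm_num)
        (show 1 ≤ j - 1 by omega)
      exact min_eq_left (by rwa [pow_one] at h4)

/-- The exponent grows by at most one per iteration, which is why more than `T` bits make every
comparison exact. -/
lemma runState_p_eq_pow {t : ℕ} (ht : t ≤ R * 2 ^ L) (x : CoinIndex V (R * 2 ^ L) k → Number b)
    (u : V) : ∃ j, 1 ≤ j ∧ j ≤ t + 1 ∧ (runState G R L t x).p u = (1 / 2) ^ j := by
  induction t with
  | zero => exact ⟨1, le_rfl, le_rfl, by simp [runState_zero, initState]⟩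
  | succ t ih =>
    obtain ⟨j, h1, h2, h3⟩ := ih (by omega)
    obtain ⟨j', h1', h2', h3'⟩ := newP_eq_pow G R L (τ := t) (ρ := coinsAt ⟨t, ht⟩ x) h1 h3
    refine ⟨j', h1', by omega, ?_⟩
    rw [← h3']
    have := runState_succ G R L ⟨t, ht⟩ x
    simp only at this
    rw [this]; rfl

lemma dyadic_runState {t : ℕ} (ht : t ≤ R * 2 ^ L) (hb : R * 2 ^ L < b)
    (x : CoinIndex V (R * 2 ^ L) k → Number b) (u : V) : Dyadic b ((runState G R L t x).p u) := by
  obtain ⟨j, h1, h2, h3⟩ := runState_p_eq_pow G R L ht x u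
  exact ⟨j, h1, by omega, h3⟩

lemma dyadic_newP_runState {t : ℕ} (ht : t < R * 2 ^ L) (hb : R * 2 ^ L < b)
    (x : CoinIndex V (R * 2 ^ L) k → Number b) (ρ : V → IterCoins k b) (u : V) :
    Dyadic b (newP G R L t ρ (runState G R L t x) u) := by
  obtain ⟨j, h1, h2, h3⟩ := runState_p_eq_pow G R L ht.le x u
  obtain ⟨j', h1', h2', h3'⟩ := newP_eq_pow G R L (τ := t) (ρ := ρ) h1 h3
  exact ⟨j', h1', by omega, h3'⟩

lemma alive_runState_anti {s t : ℕ} (hst : s ≤ t) (ht : t ≤ R * 2 ^ L)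
    (x : CoinIndex V (R * 2 ^ L) k → Number b) :
    (runState G R L t x).alive ⊆ (runState G R L s x).alive := by
  induction t, hst using Nat.le_induction with
  | base => exact subset_rfl
  | succ t _ ih =>
    have := runState_succ G R L ⟨t, ht⟩ x
    simp only at this
    rw [this]
    exact (Finset.filter_subset _ _).trans (ih (by omega))

/-- The weight of iteration `t` for the survival of `v`. -/
noncomputable def runWeight (M : ℝ) (t : ℕ) (v : V) (x : CoinIndex V (R * 2 ^ L) k → Number b) :
    ℝ :=
  if h : t < R * 2 ^ L then stepWeight G R L t (coinsAt ⟨t, h⟩ x) (runState G R L t x) M v else 1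

/-- The coordinates of the nodes of `A` in the first `m` iterations. -/
def pastBlock (T k m : ℕ) (A : Finset V) : Finset (CoinIndex V T k) :=
  Finset.univ.filter fun i => (i.1 : ℕ) < m ∧ i.2.1 ∈ A

lemma mem_pastBlock {T m : ℕ} {A : Finset V} {i : CoinIndex V T k} :
    i ∈ pastBlock T k m A ↔ (i.1 : ℕ) < m ∧ i.2.1 ∈ A := by
  simp [pastBlock]

/-- The supermartingale property. The last iteration is averaged out first, with the past fixed: the
state is then a constant, and the weights of different nodes of `S` read disjoint sets of the fresh
coins in `A`. -/
lemma avg_prod_runWeight_le {M : ℝ} (hM : 0 ≤ M) (hb : R * 2 ^ L < b) (S A : Finset V)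
    (hS : ∀ u ∈ S, ∀ v ∈ S, u ≠ v → Disjoint (closedNbhd₂ G u) (closedNbhd₂ G v))
    (hA : ∀ v ∈ S, closedNbhd₂ G v ⊆ A) {m : ℕ} (hm : m ≤ R * 2 ^ L)
    (x : CoinIndex V (R * 2 ^ L) k → Number b) :
    avg (pastBlock (R * 2 ^ L) k m A)
      (fun z => ∏ t ∈ Finset.range m, ∏ v ∈ S, runWeight G R L M t v z) x ≤
      ((1 + M * ((G.maxDegree + 1) * (1 / 5) ^ k)) ^ S.card) ^ m := by
  set c : ℝ := 1 + M * ((G.maxDegree + 1) * (1 / 5) ^ k) with hc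
  have hc0 : 0 ≤ c := by positivity
  have hw0 : ∀ t v (z : CoinIndex V (R * 2 ^ L) k → Number b), 0 ≤ runWeight G R L M t v z := by
    intro t v z
    unfold runWeight
    split_ifs
    · exact stepWeight_nonneg G hM v
    · exact zero_le_one
  induction m generalizing x with
  | zero => simpa using (avg_const _ 1 x).le
  | succ m ih =>
    have hlt : m < R * 2 ^ L := hm
    have hunion : pastBlock (R * 2 ^ L) k (m + 1) A
        = pastBlock (R * 2 ^ L) k m A ∪ coinBlock ⟨m, hlt⟩ A := by
      ext i
      rw [Finset.mem_union, mem_pastBlock, mem_pastBlock, mem_coinBlock, Fin.ext_iff, ← or_and_right]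
      exact and_congr_left fun _ => Nat.lt_succ_iff_lt_or_eq
    have hdisj : Disjoint (pastBlock (R * 2 ^ L) k m A) (coinBlock ⟨m, hlt⟩ A) := by
      refine Finset.disjoint_left.mpr fun i hi hi' => ?_
      have h1 := (mem_pastBlock.mp hi).1
      rw [(mem_coinBlock.mp hi').1] at h1
      exact lt_irrefl _ h1
    have hpast : ∀ {z z' : CoinIndex V (R * 2 ^ L) k → Number b},
        (∀ i, i ∉ coinBlock ⟨m, hlt⟩ A → z' i = z i) → ∀ t ≤ m,
        runState G R L t z' = runState G R L t z := fun {z z'} h t ht =>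
      runState_congr G R L (by omega) fun i hi => h i fun hi' => by
        rw [(mem_coinBlock.mp hi').1] at hi
        simp only at hi
        omega
    rw [hunion, avg_union hdisj]
    calc _ ≤ avg (pastBlock (R * 2 ^ L) k m A) (fun z => c ^ S.card *
          ∏ t ∈ Finset.range m, ∏ v ∈ S, runWeight G R L M t v z) x := by
          refine avg_mono fun z _ => ?_
          simp only [Finset.prod_range_succ]
          rw [avg_mul_left (g := fun z => ∏ t ∈ Finset.range m, ∏ v ∈ S, runWeight G R L M t v z)]
          · rw [mul_comm]
            refine mul_le_mul_of_nonneg_right ?_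
              (Finset.prod_nonneg fun t _ => Finset.prod_nonneg fun v _ => hw0 t v z)
            rw [← Finset.prod_const]
            refine avg_prod_le S (fun v => coinBlock ⟨m, hlt⟩ (closedNbhd₂ G v)) _ _
              (fun _ _ => hc0) (fun v _ z => hw0 m v z) ?_ z _ ?_ ?_ ?_
            · intro u hu v hv hne
              refine Finset.disjoint_left.mpr fun i hi hi' => ?_
              exact Finset.disjoint_left.mp (hS u hu v hv hne) (mem_coinBlock.mp hi).2
                (mem_coinBlock.mp hi').2
            · intro v hv i hi
              rw [mem_coinBlock] at hi ⊢
              exact ⟨hi.1, hA v hv hi.2⟩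
            · intro v _ z z' hz
              have hst : runState G R L m z = runState G R L m z' :=
                hpast (fun i hi => hz i (Or.inr hi)) m le_rfl
              rw [runWeight, runWeight, dif_pos hlt, dif_pos hlt, hst]
              exact stepWeight_congr G fun i hi => hz i (Or.inl hi)
            · intro v hv z _
              have := avg_stepWeight_le G (R := R) (L := L) (τ := m) (t := ⟨m, hlt⟩) hM
                (dyadic_runState G R L hlt.le hb z) (dyadic_newP_runState G R L hlt hb z) v z
              refine le_trans (le_of_eq ?_) this
              refine avg_congr fun z' hz' => ?_
              have hst : runState G R L m z' = runState G R L m z := by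
                refine hpast (fun i hi => hz' i fun hi' => hi ?_) m le_rfl
                rw [mem_coinBlock] at hi' ⊢
                exact ⟨hi'.1, hA v hv hi'.2⟩
              rw [runWeight, dif_pos hlt, hst]
          · intro z' hz'
            refine Finset.prod_congr rfl fun t ht => Finset.prod_congr rfl fun v _ => ?_
            have htm : t < m := Finset.mem_range.mp ht
            have htT : t < R * 2 ^ L := htm.trans hlt
            rw [runWeight, runWeight, dif_pos htT, dif_pos htT, hpast hz' t htm.le]
            refine stepWeight_congr G fun i hi => hz' i fun hi' => ?_
            have h1 := (mem_coinBlock.mp hi).1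
            rw [(mem_coinBlock.mp hi').1, Fin.mk.injEq] at h1
            omega
      _ = c ^ S.card * _ := avg_const_mul _ _ _ _
      _ ≤ c ^ S.card * (c ^ S.card) ^ m :=
          mul_le_mul_of_nonneg_left (ih hlt.le x) (pow_nonneg hc0 _)
      _ = _ := (pow_succ' _ _).symm

lemma potential_initState_le (hΔ : 1 ≤ G.maxDegree) (v : V) :
    potential G 0 (initState V) v ≤ 4 * Real.logb 2 G.maxDegree + 32 := by
  have hΔ' : (1 : ℝ) ≤ G.maxDegree := by exact_mod_cast hΔ
  have hlog0 : 0 ≤ Real.logb 2 (G.maxDegree : ℝ) := Real.logb_nonneg (by norm_num) hΔ'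
  have hd : effDeg G (initState V) v ≤ G.maxDegree / 2 := by
    have : effDeg G (initState V) v = G.degree v / 2 := by
      simp [effDeg, initState, div_eq_mul_inv]
    rw [this]
    gcongr
    exact_mod_cast G.degree_le_maxDegree v
  have hlev : degreeLevel (effDeg G (initState V) v) ≤ Real.logb 2 G.maxDegree + 8 := by
    rcases lt_or_ge (effDeg G (initState V) v) (1 / 200) with h | h
    · rw [degreeLevel_of_lt h]; linarith
    · rw [degreeLevel_of_le h]
      -- Initially `d ≤ Δ / 2`, so `200 * d ≤ 100 * Δ ≤ 2^7 * Δ`.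
      have h1 : Real.logb 2 (200 * effDeg G (initState V) v) ≤
          Real.logb 2 (2 ^ 7 * G.maxDegree) :=
        Real.logb_le_logb_of_le (by norm_num) (by linarith) (by linarith)
      rw [Real.logb_mul (x := 2 ^ 7) (by norm_num) (by linarith), Real.logb_pow,
        Real.logb_self_eq_one (by norm_num)] at h1
      push_cast at h1
      linarith
  have hp : Real.logb 2 ((initState V).p v) = -1 := by
    simp only [initState, one_div]
    rw [Real.logb_inv, Real.logb_self_eq_one (by norm_num)]
  have hs : (((initState V).stallEnd v - 0 : ℕ) : ℝ) = 0 := by simp [initState]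
  rw [potential, hp, hs]
  have := max_le (a := 4 * degreeLevel (effDeg G (initState V) v)) (b := 2 * (0 : ℝ))
    (c := 4 * Real.logb 2 G.maxDegree + 32) (by linarith) (by linarith)
  linarith

/-- A node that survives `T'` iterations without an error has seen many golden iterations. -/
lemma le_sum_golden (hR : 0 < R) (hb : R * 2 ^ L < b) (hΔ : 1 ≤ G.maxDegree) {T' : ℕ}
    (hT' : T' ≤ R * 2 ^ L) (x : CoinIndex V (R * 2 ^ L) k → Number b) {v : V}
    (hv : v ∈ (runState G R L (R * 2 ^ L) x).alive)
    (herr : ∀ t : Fin (R * 2 ^ L), (t : ℕ) < T' →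
      ¬ EstimateError G (runState G R L t x) (coinsAt t x) v) :
    (T' : ℝ) - (4 * Real.logb 2 G.maxDegree + 32) ≤
      10 * ∑ t ∈ Finset.univ.filter (fun t : Fin (R * 2 ^ L) => (t : ℕ) < T'),
        ind (Golden G R L t (coinsAt t x) (runState G R L t x) v) := by
  have key : ∀ m ≤ T', potential G m (runState G R L m x) v ≤
      potential G 0 (initState V) v - m +
      10 * ∑ t ∈ Finset.univ.filter (fun t : Fin (R * 2 ^ L) => (t : ℕ) < m),
        ind (Golden G R L t (coinsAt t x) (runState G R L t x) v) := by
    intro m hm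
    induction m with
    | zero => simp [runState_zero]
    | succ m ih =>
      have hlt : m < R * 2 ^ L := by omega
      have hfil : Finset.univ.filter (fun t : Fin (R * 2 ^ L) => (t : ℕ) < m + 1)
          = insert ⟨m, hlt⟩ (Finset.univ.filter (fun t : Fin (R * 2 ^ L) => (t : ℕ) < m)) := by
        ext t
        simp only [Finset.mem_filter, Finset.mem_univ, true_and, Finset.mem_insert, Fin.ext_iff]
        omega
      rw [hfil, Finset.sum_insert (by simp)]
      have hstep := potential_step_le G (L := L) (τ := m) (ρ := coinsAt ⟨m, hlt⟩ x) hR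
        (dyadic_runState G R L hlt.le hb x) (alive_runState_anti G R L hlt.le le_rfl x hv)
        (herr ⟨m, hlt⟩ (by simp only; omega))
      have hsucc := runState_succ G R L ⟨m, hlt⟩ x
      simp only at hsucc
      rw [hsucc]
      have := ih (by omega)
      push_cast
      linarith
  have h1 := key T' le_rfl
  have h2 := potential_nonneg G (τ := T') (dyadic_runState G R L hT' hb x v)
  have h3 := potential_initState_le G hΔ v
  linarith

lemma prod_runWeight_eq (M : ℝ) {T' : ℕ} (hT' : T' ≤ R * 2 ^ L)
    (x : CoinIndex V (R * 2 ^ L) k → Number b) (v : V) :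
    ∏ t ∈ Finset.range T', runWeight G R L M t v x =
      ∏ t ∈ Finset.univ.filter (fun t : Fin (R * 2 ^ L) => (t : ℕ) < T'),
        stepWeight G R L t (coinsAt t x) (runState G R L t x) M v := by
  symm
  refine Finset.prod_bij (fun t _ => (t : ℕ)) ?_ ?_ ?_ ?_
  · intro t ht
    exact Finset.mem_range.mpr (Finset.mem_filter.mp ht).2
  · intro t _ t' _ h
    exact Fin.ext h
  · intro t ht
    have ht' := Finset.mem_range.mp ht
    exact ⟨⟨t, by omega⟩, by simpa using ht', rfl⟩
  · intro t _
    rw [runWeight, dif_pos t.2]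

/-- A survivor never sees a success, so all its factors are at least 1. Either one error contributes
`1 + h^m` at once, or there is no error and the drift of the potential yields at least `m` golden
factors `h`. -/
lemma le_prod_runWeight (hR : 0 < R) (hb : R * 2 ^ L < b) (hΔ : 1 ≤ G.maxDegree) {T' m : ℕ}
    (hT' : T' ≤ R * 2 ^ L) (hm : 10 * (m : ℝ) + (4 * Real.logb 2 G.maxDegree + 32) ≤ T')
    (x : CoinIndex V (R * 2 ^ L) k → Number b) {v : V}
    (hv : v ∈ (runState G R L (R * 2 ^ L) x).alive) :
    (1 - hitProb)⁻¹ ^ m ≤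
      ∏ t ∈ Finset.range T', runWeight G R L ((1 - hitProb)⁻¹ ^ m) t v x := by
  set h := (1 - hitProb)⁻¹ with hh
  have hh1 : 1 ≤ h := one_le_inv_one_sub_hitProb
  have hM : 0 ≤ h ^ m := by positivity
  rw [prod_runWeight_eq G R L _ hT']
  set F := Finset.univ.filter (fun t : Fin (R * 2 ^ L) => (t : ℕ) < T')
  have hns : ∀ t : Fin (R * 2 ^ L),
      ¬ Success G R L t (coinsAt t x) (runState G R L t x) v := by
    intro t hs
    have h1 := notMem_alive_of_success G (dyadic_runState G R L t.2.le hb x) hs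
    rw [← runState_succ] at h1
    exact h1 (alive_runState_anti G R L t.2 le_rfl x hv)
  have hgold : ∀ t : Fin (R * 2 ^ L), 1 ≤ 1 + (h - 1) *
      ind (Golden G R L t (coinsAt t x) (runState G R L t x) v) := fun t =>
    le_add_of_nonneg_right (mul_nonneg (by linarith) (ind_nonneg _))
  have herr : ∀ t : Fin (R * 2 ^ L), 1 ≤ 1 + h ^ m *
      ind (EstimateError G (runState G R L t x) (coinsAt t x) v) := fun t =>
    le_add_of_nonneg_right (mul_nonneg hM (ind_nonneg _))
  have hweight : ∀ t : Fin (R * 2 ^ L),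
      stepWeight G R L t (coinsAt t x) (runState G R L t x) (h ^ m) v =
      (1 + h ^ m * ind (EstimateError G (runState G R L t x) (coinsAt t x) v)) *
      (1 + (h - 1) * ind (Golden G R L t (coinsAt t x) (runState G R L t x) v)) := by
    intro t
    rw [stepWeight, ind_of (hns t), mul_one]
  rw [Finset.prod_congr rfl fun t _ => hweight t, Finset.prod_mul_distrib]
  have hp1 : 1 ≤ ∏ t ∈ F, (1 + (h - 1) *
      ind (Golden G R L t (coinsAt t x) (runState G R L t x) v)) := by
    simpa using Finset.prod_le_prod (s := F) (f := fun _ => (1 : ℝ)) (fun _ _ => zero_le_one)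
      fun t _ => hgold t
  have hp2 : 1 ≤ ∏ t ∈ F, (1 + h ^ m *
      ind (EstimateError G (runState G R L t x) (coinsAt t x) v)) := by
    simpa using Finset.prod_le_prod (s := F) (f := fun _ => (1 : ℝ)) (fun _ _ => zero_le_one)
      fun t _ => herr t
  by_cases hex : ∃ t ∈ F, EstimateError G (runState G R L t x) (coinsAt t x) v
  · obtain ⟨t, ht, he⟩ := hex
    refine le_trans ?_ (le_mul_of_one_le_right (zero_le_one.trans hp2) hp1)
    rw [← Finset.mul_prod_erase F _ ht, ind_of he, mul_one]
    have hrest : 1 ≤ ∏ t ∈ F.erase t, (1 + h ^ m *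
        ind (EstimateError G (runState G R L t x) (coinsAt t x) v)) := by
      simpa using Finset.prod_le_prod (s := F.erase t) (f := fun _ => (1 : ℝ))
        (fun _ _ => zero_le_one) fun t _ => herr t
    nlinarith
  · push Not at hex
    refine le_trans ?_ (le_mul_of_one_le_left (zero_le_one.trans hp1) hp2)
    have hsum := le_sum_golden G R L hR hb hΔ hT' x hv fun t ht =>
      hex t (Finset.mem_filter.mpr ⟨Finset.mem_univ _, ht⟩)
    classical
    set N := F.filter fun t : Fin (R * 2 ^ L) => Golden G R L t (coinsAt t x) (runState G R L t x) v
    have hcard : ∑ t ∈ F, ind (Golden G R L t (coinsAt t x) (runState G R L t x) v) =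
        (N.card : ℝ) := by
      simp only [ind, N]
      rw [← Finset.sum_boole]
    have hprod : ∏ t ∈ F, (1 + (h - 1) *
        ind (Golden G R L t (coinsAt t x) (runState G R L t x) v)) = h ^ N.card := by
      rw [← Finset.prod_const, Finset.prod_filter (s := F)]
      refine Finset.prod_congr rfl fun t _ => ?_
      by_cases hg : Golden G R L t (coinsAt t x) (runState G R L t x) v
      · rw [ind_of hg, if_pos hg]; ring
      · rw [ind_of_not hg, if_neg hg]; ring
    rw [hprod]
    refine pow_le_pow_right₀ hh1 ?_
    rw [hcard] at hsum
    have : (m : ℝ) ≤ N.card := by linarith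
    exact_mod_cast this

/-- The survival of several nodes with disjoint neighborhoods. -/
lemma avg_alive_le (hR : 0 < R) (hb : R * 2 ^ L < b) (hΔ : 1 ≤ G.maxDegree) {T' m : ℕ}
    (hT' : T' ≤ R * 2 ^ L) (hm : 10 * (m : ℝ) + (4 * Real.logb 2 G.maxDegree + 32) ≤ T')
    (S A : Finset V)
    (hS : ∀ u ∈ S, ∀ v ∈ S, u ≠ v → Disjoint (closedNbhd₂ G u) (closedNbhd₂ G v))
    (hA : ∀ v ∈ S, closedNbhd₂ G v ⊆ A) (x : CoinIndex V (R * 2 ^ L) k → Number b) :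
    avg (pastBlock (R * 2 ^ L) k (R * 2 ^ L) A)
      (fun z => ind (∀ v ∈ S, v ∈ (runState G R L (R * 2 ^ L) z).alive)) x ≤
      ((1 + (1 - hitProb)⁻¹ ^ m * ((G.maxDegree + 1) * (1 / 5) ^ k)) ^ T' /
        (1 - hitProb)⁻¹ ^ m) ^ S.card := by
  set h := (1 - hitProb)⁻¹ with hh
  have hh1 : 1 ≤ h := one_le_inv_one_sub_hitProb
  have hM : 0 ≤ h ^ m := by positivity
  have hMpos : 0 < (h ^ m) ^ S.card := by positivity
  have hsub : pastBlock (R * 2 ^ L) k T' A ⊆ pastBlock (R * 2 ^ L) k (R * 2 ^ L) A := by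
    intro i hi
    rw [mem_pastBlock] at hi ⊢
    exact ⟨by omega, hi.2⟩
  have hbound : avg (pastBlock (R * 2 ^ L) k (R * 2 ^ L) A)
      (fun z => ∏ t ∈ Finset.range T', ∏ v ∈ S, runWeight G R L (h ^ m) t v z) x ≤
      ((1 + h ^ m * ((G.maxDegree + 1) * (1 / 5) ^ k)) ^ S.card) ^ T' :=
    avg_le_of_subset hsub fun z _ => avg_prod_runWeight_le G R L hM hb S A hS hA hT' z
  rw [pow_right_comm] at hbound
  rw [div_pow, le_div_iff₀ hMpos]
  -- Markov's inequality: if all of `S` survives, the product of all weights is at least `(h ^ m) ^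
  -- S.card`.
  refine le_trans (le_of_eq ?_) (le_trans (avg_mono (f := fun z => (h ^ m) ^ S.card *
    ind (∀ v ∈ S, v ∈ (runState G R L (R * 2 ^ L) z).alive)) fun z _ => ?_) hbound)
  · rw [avg_const_mul, mul_comm]
  · rw [Finset.prod_comm, ind_forall_mem, ← Finset.prod_const, ← Finset.prod_mul_distrib]
    refine Finset.prod_le_prod (fun v _ => mul_nonneg hM (ind_nonneg _)) fun v _ => ?_
    by_cases hv : v ∈ (runState G R L (R * 2 ^ L) z).alive
    · rw [ind_of hv, mul_one]
      exact le_prod_runWeight G R L hR hb hΔ hT' hm z hv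
    · rw [ind_of_not hv, mul_zero]
      refine Finset.prod_nonneg fun t _ => ?_
      unfold runWeight
      split_ifs
      · exact stepWeight_nonneg G hM v
      · exact zero_le_one

end Execution

end RecursiveMIS

/-! ### Numerical constants. -/

namespace RecursiveMIS

/-- The constant in the number of iterations. -/
noncomputable def iterConst : ℝ := 4000 / hitProb

lemma iterConst_ge : 8000 ≤ iterConst := by
  rw [iterConst, le_div_iff₀ hitProb_pos]
  linarith [hitProb_le_half]

lemma rpow_two_logb {D : ℝ} (hD : 0 < D) : (2 : ℝ) ^ Real.logb 2 D = D :=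
  Real.rpow_logb (by norm_num) (by norm_num) hD

/-- Since `(1 - η)⁻¹ ≥ exp η` for `η = hitProb` and `iterConst * η = 4000`, the exponent `m * η` is
at least `100 * log₂ D`. -/
lemma pow_hundred_le_inv_pow {D : ℝ} (hD : 3 ≤ D) {m : ℕ}
    (hm : iterConst * Real.logb 2 D / 40 ≤ m) : D ^ 100 ≤ (1 - hitProb)⁻¹ ^ m := by
  have hD0 : 0 < D := by linarith
  have hη := hitProb_pos
  have hlog0 : 0 ≤ Real.logb 2 D := Real.logb_nonneg (by norm_num) (by linarith)
  have h1 : Real.exp hitProb ≤ (1 - hitProb)⁻¹ := by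
    rw [← neg_neg hitProb, Real.exp_neg, neg_neg]
    refine inv_anti₀ (by linarith [hitProb_le_half]) ?_
    linarith [Real.add_one_le_exp (-hitProb)]
  have h2 : Real.log D ≤ Real.logb 2 D := by
    rw [Real.logb, le_div_iff₀ (Real.log_pos (by norm_num))]
    have := Real.log_two_lt_d9
    have hlogD : 0 ≤ Real.log D := Real.log_nonneg (by linarith)
    nlinarith
  calc D ^ 100 = Real.exp (100 * Real.log D) := by
        rw [show (100 : ℝ) = ((100 : ℕ) : ℝ) by norm_num, Real.exp_nat_mul, Real.exp_log hD0]
    _ ≤ Real.exp (m * hitProb) := by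
        refine Real.exp_le_exp.mpr ?_
        have h3 : iterConst * hitProb = 4000 := by
          rw [iterConst]; field_simp
        have h4 := mul_le_mul_of_nonneg_right hm hη.le
        have h5 : iterConst * Real.logb 2 D / 40 * hitProb = 100 * Real.logb 2 D := by
          rw [show iterConst * Real.logb 2 D / 40 * hitProb
            = (iterConst * hitProb) * Real.logb 2 D / 40 by ring, h3]; ring
        linarith
    _ = Real.exp hitProb ^ m := Real.exp_nat_mul _ _
    _ ≤ _ := pow_le_pow_left₀ (Real.exp_pos _).le h1 m

/-- The number of iterations and the weight of an error are each at most `2 ^ (2 * iterConst * log₂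
D)`, while `k` repetitions make errors rarer than `2 ^ (-12 * C * log₂ D)`; `C ≥ iterConst` wins. -/
lemma error_factor_le_two {D : ℝ} (hD : 3 ≤ D) {C : ℝ} (hC : iterConst ≤ C) {T' m k : ℕ}
    (hT' : (T' : ℝ) ≤ 2 * iterConst * Real.logb 2 D) (hmT : m ≤ T')
    (hk : 12 * C * Real.logb 2 D ≤ k) :
    (1 + (1 - hitProb)⁻¹ ^ m * ((D + 1) * (1 / 5) ^ k)) ^ T' ≤ 2 := by
  set lg := Real.logb 2 D with hlg
  set h := (1 - hitProb)⁻¹ with hh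
  have hD2 : (2 : ℝ) ^ lg = D := rpow_two_logb (by linarith)
  have hlg1 : 1 ≤ lg := by
    rw [hlg, Real.le_logb_iff_rpow_le (by norm_num) (by linarith)]
    simp; linarith
  have hc := iterConst_ge
  have hh1 : 1 ≤ h := one_le_inv_one_sub_hitProb
  have hh2 : h ≤ 2 := by
    rw [hh, inv_le_comm₀ (by linarith [hitProb_le_half]) (by norm_num)]
    linarith [hitProb_le_half]
  have e1 : h ^ m ≤ 2 ^ (2 * iterConst * lg) := by
    calc h ^ m ≤ 2 ^ m := pow_le_pow_left₀ (by linarith) hh2 m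
      _ ≤ 2 ^ T' := pow_le_pow_right₀ (by norm_num) hmT
      _ = (2 : ℝ) ^ (T' : ℝ) := (Real.rpow_natCast _ _).symm
      _ ≤ _ := Real.rpow_le_rpow_of_exponent_le (by norm_num) hT'
  have e2 : (T' : ℝ) ≤ 2 ^ (2 * iterConst * lg) := by
    calc (T' : ℝ) ≤ 2 ^ T' := by exact_mod_cast Nat.lt_two_pow_self.le
      _ = (2 : ℝ) ^ (T' : ℝ) := (Real.rpow_natCast _ _).symm
      _ ≤ _ := Real.rpow_le_rpow_of_exponent_le (by norm_num) hT'
  have e3 : D + 1 ≤ 2 ^ (2 * lg) := by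
    rw [mul_comm, Real.rpow_mul (by norm_num), hD2, Real.rpow_two]
    nlinarith
  have e4 : ((1 : ℝ) / 5) ^ k ≤ 2 ^ (-(12 * C * lg)) := by
    calc ((1 : ℝ) / 5) ^ k ≤ (1 / 2) ^ k := pow_le_pow_left₀ (by norm_num) (by norm_num) k
      _ = (2 : ℝ) ^ (-(k : ℝ)) := by
          rw [Real.rpow_neg (by norm_num), Real.rpow_natCast, one_div, inv_pow]
      _ ≤ _ := Real.rpow_le_rpow_of_exponent_le (by norm_num) (by linarith)
  have e5 : (T' : ℝ) * (h ^ m * ((D + 1) * (1 / 5) ^ k)) ≤ 1 / 2 := by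
    calc (T' : ℝ) * (h ^ m * ((D + 1) * (1 / 5) ^ k))
        ≤ 2 ^ (2 * iterConst * lg) * (2 ^ (2 * iterConst * lg) *
            (2 ^ (2 * lg) * 2 ^ (-(12 * C * lg)))) := by
          gcongr
      _ = (2 : ℝ) ^ (4 * iterConst * lg + 2 * lg - 12 * C * lg) := by
          rw [← Real.rpow_add (by norm_num), ← Real.rpow_add (by norm_num),
            ← Real.rpow_add (by norm_num)]
          congr 1; ring
      _ ≤ (2 : ℝ) ^ (-1 : ℝ) := by
          refine Real.rpow_le_rpow_of_exponent_le (by norm_num) ?_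
          nlinarith [mul_le_mul_of_nonneg_right hC (by linarith : 0 ≤ lg),
            mul_le_mul_of_nonneg_right hc (by linarith : 0 ≤ lg)]
      _ = 1 / 2 := by rw [Real.rpow_neg_one]; norm_num
  set y := h ^ m * ((D + 1) * (1 / 5) ^ k) with hy
  have hy0 : 0 ≤ y := by positivity
  calc (1 + y) ^ T' ≤ Real.exp y ^ T' :=
        pow_le_pow_left₀ (by linarith) (by linarith [Real.add_one_le_exp y]) T'
    _ = Real.exp (T' * y) := (Real.exp_nat_mul _ _).symm
    _ ≤ Real.exp (1 / 2) := Real.exp_le_exp.mpr e5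
    _ ≤ 2 := by
        have h1 : Real.exp (1 / 2) ^ 2 = Real.exp 1 := by
          rw [← Real.exp_nat_mul]; norm_num
        have h2 := Real.exp_one_lt_d9
        nlinarith [Real.exp_pos (1 / 2)]

/-! ### The survival bound and its translation into conditional probabilities. -/

section Main

variable {V : Type*} [Fintype V] [DecidableEq V] (G : SimpleGraph V) [DecidableRel G.Adj]
variable {k b : ℕ} (R L : ℕ)

lemma avg_alive_le_pow (hR : 0 < R) (hb : R * 2 ^ L < b) (hΔ : 3 ≤ G.maxDegree) {C : ℝ}
    (hC : iterConst ≤ C) (hT : iterConst * Real.logb 2 G.maxDegree ≤ ((R * 2 ^ L : ℕ) : ℝ))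
    (hk : 12 * C * Real.logb 2 G.maxDegree ≤ k) (S A : Finset V)
    (hS : ∀ u ∈ S, ∀ v ∈ S, u ≠ v → Disjoint (closedNbhd₂ G u) (closedNbhd₂ G v))
    (hA : ∀ v ∈ S, closedNbhd₂ G v ⊆ A) (x : CoinIndex V (R * 2 ^ L) k → Number b) :
    avg (pastBlock (R * 2 ^ L) k (R * 2 ^ L) A)
      (fun z => ind (∀ v ∈ S, v ∈ (runState G R L (R * 2 ^ L) z).alive)) x ≤
      (1 / (G.maxDegree : ℝ) ^ 99) ^ S.card := by
  set D : ℝ := (G.maxDegree : ℝ) with hD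
  have hD3 : 3 ≤ D := by rw [hD]; exact_mod_cast hΔ
  set lg := Real.logb 2 D with hlg
  have hlg1 : 1 ≤ lg := by
    rw [hlg, Real.le_logb_iff_rpow_le (by norm_num) (by linarith)]
    simp; linarith
  have hc := iterConst_ge
  have hclg : 8000 * lg ≤ iterConst * lg := mul_le_mul_of_nonneg_right hc (by linarith)
  have hclg0 : 0 ≤ iterConst * lg := by linarith
  -- Only about `iterConst * log Δ` iterations are analysed. The run may be much longer, but `C` is
  -- not tied to `c`, so the errors of all iterations need not be controllable; later iterations can
  -- only remove more nodes.
  set T' := ⌈iterConst * lg⌉₊ with hT'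
  -- Then `10 * m` uses at most half of `T'` and the other half exceeds the initial potential, while
  -- `m ≥ iterConst * lg / 40` despite the rounding.
  set m := ⌊iterConst * lg / 20⌋₊ with hm
  have hT'1 : iterConst * lg ≤ T' := Nat.le_ceil _
  have hT'2 : (T' : ℝ) < iterConst * lg + 1 := Nat.ceil_lt_add_one hclg0
  have hm1 : (m : ℝ) ≤ iterConst * lg / 20 := Nat.floor_le (by linarith)
  have hm2 : iterConst * lg / 20 < m + 1 := Nat.lt_floor_add_one _
  have hTle : T' ≤ R * 2 ^ L := Nat.ceil_le.mpr hT
  have hmT : m ≤ T' := by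
    have : (m : ℝ) ≤ T' := by linarith
    exact_mod_cast this
  refine (avg_alive_le G R L hR hb (by omega) (m := m) hTle ?_ S A hS hA x).trans ?_
  · rw [← hD, ← hlg]; linarith
  have h1 := error_factor_le_two hD3 hC (T' := T') (m := m) (k := k) (by linarith) hmT hk
  have h2 := pow_hundred_le_inv_pow hD3 (m := m) (by linarith)
  rw [← hD]
  have hpos : 0 < D ^ 99 := by positivity
  have hh1 := one_le_inv_one_sub_hitProb
  have hnum : 0 ≤ (1 + (1 - hitProb)⁻¹ ^ m * ((D + 1) * (1 / 5) ^ k)) ^ T' := by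
    have : 0 ≤ (1 - hitProb)⁻¹ := by linarith
    positivity
  refine pow_le_pow_left₀ (div_nonneg hnum (by positivity)) ?_ _
  rw [div_le_div_iff₀ (by positivity) hpos, one_mul]
  calc _ ≤ 2 * D ^ 99 := mul_le_mul_of_nonneg_right h1 hpos.le
    _ ≤ D * D ^ 99 := mul_le_mul_of_nonneg_right (by linarith) hpos.le
    _ = D ^ 100 := by ring
    _ ≤ _ := h2

lemma toCoins_injective {T : ℕ} : Function.Injective (toCoins (V := V) (T := T) (k := k) (b := b)) := by
  intro x y h
  funext ⟨t, v, o⟩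
  have h1 := congrFun (congrFun h v) t
  cases o with
  | none => exact congrArg Prod.snd h1
  | some j => exact congrFun (congrArg Prod.fst h1) j

/-- The family of all random numbers of given coins. -/
def ofCoins {T : ℕ} (ω : Coins V T k b) : CoinIndex V T k → Number b :=
  fun i => i.2.2.elim (ω i.2.1 i.1).2 (ω i.2.1 i.1).1

lemma toCoins_ofCoins {T : ℕ} (ω : Coins V T k b) : toCoins (ofCoins ω) = ω := rfl

/-- Conditional probabilities given the coins outside `A` are averages over the coins of `A`. -/
lemma uniformOn_real_eq_avg {T : ℕ} (A : Finset V) (η : Coins V T k b) (E : Set (Coins V T k b)) :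
    (uniformOn {ω : Coins V T k b | ∀ u, u ∉ A → ω u = η u}).real E =
      avg (pastBlock T k T A) (fun z => ind (toCoins z ∈ E)) (ofCoins η) := by
  classical
  set O : Set (Coins V T k b) := {ω | ∀ u, u ∉ A → ω u = η u} with hO
  set s := pastBlock T k T A with hs
  let f : (s → Number b) → Coins V T k b :=
    fun y => toCoins (Function.updateFinset (ofCoins η) s y)
  have hf : Function.Injective f := by
    intro y y' h
    have h1 := toCoins_injective h
    funext i
    have h2 := congrFun h1 i
    simpa [Function.updateFinset] using h2
  have himg : Finset.univ.image f = O.toFinset := by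
    ext ω
    simp only [Finset.mem_image, Finset.mem_univ, true_and, Set.mem_toFinset]
    constructor
    · rintro ⟨y, rfl⟩ u hu
      have : ∀ t o, (t, u, o) ∉ s := fun t o h => hu (mem_pastBlock.mp h).2
      funext t
      have h0 : ∀ o, Function.updateFinset (ofCoins η) s y (t, u, o) = ofCoins η (t, u, o) :=
        fun o => updateFinset_of_notMem s _ y (this t o)
      exact Prod.ext (funext fun j => h0 (some j)) (h0 none)
    · intro hω
      refine ⟨fun i => ofCoins ω i, ?_⟩
      have hupd : Function.updateFinset (ofCoins η) s (fun i => ofCoins ω i) = ofCoins ω := by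
        funext i
        by_cases hi : i ∈ s
        · simp [Function.updateFinset, hi]
        rw [updateFinset_of_notMem s _ _ hi]
        have : i.2.1 ∉ A := fun h => hi (mem_pastBlock.mpr ⟨i.1.2, h⟩)
        simp only [ofCoins]
        rw [hω _ this]
      simp only [f]
      rw [hupd, toCoins_ofCoins]
  have hcardO : O.toFinset.card = Fintype.card (s → Number b) := by
    rw [← himg, Finset.card_image_of_injective _ hf, Finset.card_univ]
  have hcardE : (O.toFinset ∩ E.toFinset).card =
      (Finset.univ.filter fun y => f y ∈ E).card := by
    rw [← Finset.card_image_of_injective _ hf]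
    congr 1
    ext ω
    rw [← himg]
    simp only [Finset.mem_inter, Finset.mem_image, Finset.mem_univ, true_and, Set.mem_toFinset,
      Finset.mem_filter]
    constructor
    · rintro ⟨⟨y, rfl⟩, h⟩
      exact ⟨y, h, rfl⟩
    · rintro ⟨y, h, rfl⟩
      exact ⟨⟨y, rfl⟩, h⟩
  have hunif : uniformOn O E = ((O.toFinset ∩ E.toFinset).card : ENNReal) / O.toFinset.card := by
    rw [← uniformOn_apply_finset, Set.coe_toFinset, Set.coe_toFinset]
  rw [Measure.real, hunif, ENNReal.toReal_div, ENNReal.toReal_natCast, ENNReal.toReal_natCast,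
    hcardO, hcardE, avg, Fintype.expect_eq_sum_div_card]
  simp only [ind, f]
  rw [Finset.sum_boole]

lemma coinMeasure_real_eq_avg {T : ℕ} (η : Coins V T k b) (E : Set (Coins V T k b)) :
    (coinMeasure V T k b).real E =
      avg (pastBlock T k T Finset.univ) (fun z => ind (toCoins z ∈ E)) (ofCoins η) := by
  rw [← uniformOn_real_eq_avg, coinMeasure]
  congr 2
  ext ω
  simp

lemma coinMeasure_cond_outsideCoins {T : ℕ} (v : V) (η : Coins V T k b) (A : Finset V)
    (hA : ∀ u, u ∈ A ↔ G.edist v u ≤ 2) :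
    (coinMeasure V T k b)[|outsideCoins G v η] =
      uniformOn {ω : Coins V T k b | ∀ u, u ∉ A → ω u = η u} := by
  have hset : outsideCoins G v η = {ω : Coins V T k b | ∀ u, u ∉ A → ω u = η u} := by
    simp only [outsideCoins, hA]
  rw [hset, coinMeasure, uniformOn, uniformOn,
    cond_cond_eq_cond_inter' .univ (Set.toFinite _).measurableSet
      (Measure.count_apply_lt_top.2 (Set.toFinite _)).ne, Set.univ_inter]

/-- A node disappears only when it or a neighbor joins, and a node that has joined stays in the set.
-/
lemma covered_of_notMem_alive {k b : ℕ} (ω : Coins V (R * 2 ^ L) k b) {v : V}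
    (h : v ∉ remaining G R L ω) : ω ∈ covered G R L k b v := by
  have key : ∀ t, v ∉ (stateAt G R L ω t).alive →
      v ∈ (stateAt G R L ω t).mis ∨ ∃ u, G.Adj v u ∧ u ∈ (stateAt G R L ω t).mis := by
    intro t
    induction t with
    | zero => intro h; simp [stateAt, initState] at h
    | succ t ih =>
      rw [stateAt]
      split_ifs with ht
      · intro h
        simp only [step, Finset.mem_union]
        by_cases hv : v ∈ (stateAt G R L ω t).alive
        · simp only [step, Finset.mem_filter, hv, true_and, not_and_or, not_not] at h
          push Not at h
          rcases h with h | ⟨u, hu, h⟩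
          · exact Or.inl (Or.inr h)
          · exact Or.inr ⟨u, hu, Or.inr h⟩
        · rcases ih hv with h | ⟨u, hu, h⟩
          · exact Or.inl (Or.inl h)
          · exact Or.inr ⟨u, hu, Or.inl h⟩
      · exact ih
  exact key _ h

lemma edist_le_two_of_mem_closedNbhd₂ {u v : V} (h : u ∈ closedNbhd₂ G v) : G.edist v u ≤ 2 := by
  have h1 : ∀ {a c : V}, c ∈ closedNbhd G a → G.edist a c ≤ 1 := by
    intro a c hc
    rw [SimpleGraph.edist_le_one_iff_adj_or_eq]
    rcases Finset.mem_insert.mp hc with rfl | hc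
    · exact Or.inr rfl
    · exact Or.inl ((G.mem_neighborFinset a c).mp hc)
  obtain ⟨w, hw, hu⟩ := Finset.mem_biUnion.mp h
  calc G.edist v u ≤ G.edist v w + G.edist w u := SimpleGraph.edist_triangle
    _ ≤ 1 + 1 := add_le_add (h1 hw) (h1 hu)
    _ = 2 := by norm_num

/-- The set `A` is left free so that one bound serves both claims about `v`: all nodes give the
plain probability, the ball of radius 2 the conditional one. -/
lemma le_avg_covered (hR : 0 < R) (hb : R * 2 ^ L < b) (hΔ : 3 ≤ G.maxDegree) {C : ℝ}
    (hC : iterConst ≤ C) (hT : iterConst * Real.logb 2 G.maxDegree ≤ ((R * 2 ^ L : ℕ) : ℝ))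
    (hk : 12 * C * Real.logb 2 G.maxDegree ≤ k) (v : V) (A : Finset V)
    (hA : closedNbhd₂ G v ⊆ A) (x : CoinIndex V (R * 2 ^ L) k → Number b) :
    1 - 1 / (G.maxDegree : ℝ) ^ 98 ≤ avg (pastBlock (R * 2 ^ L) k (R * 2 ^ L) A)
      (fun z => ind (toCoins z ∈ covered G R L k b v)) x := by
  have h := avg_alive_le_pow G R L hR hb hΔ hC hT hk {v} A (by simp) (by simpa using hA) x
  simp only [Finset.mem_singleton, forall_eq, Finset.card_singleton, pow_one] at h
  have hD : (1 : ℝ) ≤ G.maxDegree := by exact_mod_cast (by omega : 1 ≤ G.maxDegree)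
  have hpow : 1 / (G.maxDegree : ℝ) ^ 99 ≤ 1 / (G.maxDegree : ℝ) ^ 98 :=
    one_div_le_one_div_of_le (by positivity) (pow_le_pow_right₀ hD (by norm_num))
  have hmono : avg (pastBlock (R * 2 ^ L) k (R * 2 ^ L) A) (fun z =>
      1 - ind (v ∈ (runState G R L (R * 2 ^ L) z).alive)) x ≤
      avg (pastBlock (R * 2 ^ L) k (R * 2 ^ L) A)
        (fun z => ind (toCoins z ∈ covered G R L k b v)) x := by
    refine avg_mono fun z _ => ?_
    rw [← ind_not]
    exact ind_mono fun hv => covered_of_notMem_alive G R L _ hv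
  rw [avg_sub, avg_const] at hmono
  linarith

end Main

end RecursiveMIS

/-! ### Separated nodes in large components. -/

namespace RecursiveMIS

section Shattering

variable {V : Type*} [Fintype V] [DecidableEq V] (G : SimpleGraph V) [DecidableRel G.Adj]

/-- The nodes at distance at most `r` from `v`. -/
noncomputable def nodeBall (r : ℕ) (v : V) : Finset V :=
  open Classical in Finset.univ.filter fun u => G.edist v u ≤ r

lemma mem_nodeBall {r : ℕ} {u v : V} : u ∈ nodeBall G r v ↔ G.edist v u ≤ r := by
  simp [nodeBall]

lemma card_closedNbhd_le (v : V) : (closedNbhd G v).card ≤ G.maxDegree + 1 := by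
  refine (Finset.card_insert_le _ _).trans ?_
  rw [SimpleGraph.card_neighborFinset_eq_degree]
  exact Nat.add_le_add_right (G.degree_le_maxDegree v) 1

lemma card_nodeBall_le (r : ℕ) (v : V) : (nodeBall G r v).card ≤ (G.maxDegree + 1) ^ r := by
  induction r generalizing v with
  | zero =>
    have : nodeBall G 0 v ⊆ {v} := by
      intro u hu
      have h := (mem_nodeBall G).mp hu
      simp only [Nat.cast_zero, nonpos_iff_eq_zero, SimpleGraph.edist_eq_zero_iff] at h
      exact Finset.mem_singleton.mpr h.symm
    simpa using Finset.card_le_card this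
  | succ r ih =>
    have hsub : nodeBall G (r + 1) v ⊆ (closedNbhd G v).biUnion (nodeBall G r) := by
      intro u hu
      have h := (mem_nodeBall G).mp hu
      obtain ⟨p, hp⟩ := G.exists_walk_of_edist_ne_top
        (ne_top_of_le_ne_top (ENat.natCast_ne_top _) h)
      rw [← hp] at h
      cases p with
      | nil =>
        exact Finset.mem_biUnion.mpr ⟨v, self_mem_closedNbhd G v, by simp [mem_nodeBall]⟩
      | @cons _ w _ hvw q =>
        refine Finset.mem_biUnion.mpr ⟨w, neighborFinset_subset_closedNbhd G v
          ((G.mem_neighborFinset v w).mpr hvw), (mem_nodeBall G).mpr ?_⟩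
        refine (SimpleGraph.edist_le q).trans ?_
        rw [SimpleGraph.Walk.length_cons] at h
        have h' : q.length + 1 ≤ r + 1 := by exact_mod_cast h
        exact_mod_cast Nat.le_of_succ_le_succ h'
    calc (nodeBall G (r + 1) v).card ≤ ((closedNbhd G v).biUnion (nodeBall G r)).card :=
          Finset.card_le_card hsub
      _ ≤ (closedNbhd G v).card * (G.maxDegree + 1) ^ r :=
          Finset.card_biUnion_le_card_mul _ _ _ fun w _ => ih w
      _ ≤ (G.maxDegree + 1) * (G.maxDegree + 1) ^ r :=
          Nat.mul_le_mul_right _ (card_closedNbhd_le G v)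
      _ = _ := (pow_succ' _ _).symm

lemma disjoint_closedNbhd₂ {u v : V} (h : v ∉ nodeBall G 4 u) :
    Disjoint (closedNbhd₂ G u) (closedNbhd₂ G v) := by
  refine Finset.disjoint_left.mpr fun w hu hv => h ((mem_nodeBall G).mpr ?_)
  calc G.edist u v ≤ G.edist u w + G.edist w v := SimpleGraph.edist_triangle
    _ ≤ 2 + 2 := add_le_add (edist_le_two_of_mem_closedNbhd₂ G hu)
        (SimpleGraph.edist_comm.trans_le (edist_le_two_of_mem_closedNbhd₂ G hv))
    _ = ((4 : ℕ) : ℕ∞) := by norm_num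

/-- The possible extensions of a list of nodes by a node near its head. -/
noncomputable def extendList (r : ℕ) : List V → Finset (List V)
  | [] => ∅
  | v :: l => (nodeBall G r v).image fun u => u :: v :: l

/-- The lists of `m + 1` nodes with steps of length at most `r`. -/
noncomputable def stepLists (r : ℕ) : ℕ → Finset (List V)
  | 0 => Finset.univ.image fun v => [v]
  | m + 1 => (stepLists r m).biUnion (extendList G r)

lemma card_stepLists_le (r m : ℕ) :
    (stepLists G r m).card ≤ Fintype.card V * ((G.maxDegree + 1) ^ r) ^ m := by
  induction m with
  | zero => simpa [stepLists] using Finset.card_image_le (s := Finset.univ) (f := fun v : V => [v])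
  | succ m ih =>
    rw [stepLists, pow_succ, ← mul_assoc]
    refine (Finset.card_biUnion_le_card_mul _ _ ((G.maxDegree + 1) ^ r) fun l _ => ?_).trans
      (Nat.mul_le_mul_right _ ih)
    cases l with
    | nil => simp [extendList]
    | cons v l => exact Finset.card_image_le.trans (card_nodeBall_le G r v)

lemma mem_stepLists {r m : ℕ} {l : List V} (hl : l.IsChain fun u v => u ∈ nodeBall G r v)
    (hm : l.length = m + 1) : l ∈ stepLists G r m := by
  induction m generalizing l with
  | zero =>
    obtain ⟨v, rfl⟩ := List.length_eq_one_iff.mp hm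
    simp [stepLists]
  | succ m ih =>
    match l, hl, hm with
    | u :: v :: l, hl, hm =>
      rw [List.isChain_cons_cons] at hl
      refine Finset.mem_biUnion.mpr ⟨v :: l, ih hl.2 (by simpa using hm), ?_⟩
      exact Finset.mem_image_of_mem _ hl.1

/-- Attaches `w` as a leaf at `u` by a round trip. A tree is thus recorded by a traversal, so that
counting lists replaces counting trees, at a cost of two entries per node. -/
lemma isChain_insert_detour {α : Type*} {r : α → α → Prop} {l₁ l₂ : List α} {u w : α}
    (h : (l₁ ++ u :: l₂).IsChain r) (h1 : r u w) (h2 : r w u) :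
    (l₁ ++ u :: w :: u :: l₂).IsChain r := by
  induction l₁ with
  | nil => simpa [List.isChain_cons_cons, h1, h2] using h
  | cons a l₁ ih =>
    cases l₁ with
    | nil =>
      simp only [List.cons_append, List.nil_append, List.isChain_cons_cons] at h ⊢
      exact ⟨h.1, h1, h2, h.2⟩
    | cons a' l₁ =>
      simp only [List.cons_append, List.isChain_cons_cons] at h ih ⊢
      exact ⟨h.1, ih h.2⟩

/-- A large connected set of nodes contains many well separated nodes that a list with short steps
runs through. -/
lemma exists_separated_list (K : Finset V) (hK : K.Nonempty)
    (hconn : ∀ U : Finset V, (∃ x ∈ K, x ∈ U) → (∃ y ∈ K, y ∉ U) →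
      ∃ a ∈ K, ∃ c ∈ K, G.Adj a c ∧ a ∈ U ∧ c ∉ U)
    (s : ℕ) (hs : s * (G.maxDegree + 1) ^ 4 < K.card) :
    ∃ l : List V, l.length = 2 * s + 1 ∧ (l.IsChain fun u v => u ∈ nodeBall G 5 v) ∧
      l.toFinset.card = s + 1 ∧ l.toFinset ⊆ K ∧
      ∀ u ∈ l.toFinset, ∀ v ∈ l.toFinset, u ≠ v → v ∉ nodeBall G 4 u := by
  induction s with
  | zero =>
    obtain ⟨v, hv⟩ := hK
    refine ⟨[v], rfl, List.isChain_singleton v, by simp, by simpa using hv, ?_⟩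
    intro u hu w hw hne
    simp only [List.toFinset_cons, List.toFinset_nil, Finset.mem_insert, Finset.notMem_empty,
      or_false] at hu hw
    exact absurd (hu.trans hw.symm) hne
  | succ s ih =>
    obtain ⟨l, hlen, hchain, hcard, hlK, hsep⟩ :=
      ih (lt_of_le_of_lt (Nat.mul_le_mul_right _ (Nat.le_succ s)) hs)
    set U := l.toFinset.biUnion (nodeBall G 4) with hU
    have hUcard : U.card ≤ (s + 1) * (G.maxDegree + 1) ^ 4 := by
      rw [← hcard]
      exact Finset.card_biUnion_le_card_mul _ _ _ fun w _ => card_nodeBall_le G 4 w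
    have hself : ∀ u ∈ l.toFinset, u ∈ U := fun u hu =>
      Finset.mem_biUnion.mpr ⟨u, hu, by simp [mem_nodeBall]⟩
    obtain ⟨y, hy, hyU⟩ : ∃ y ∈ K, y ∉ U := by
      by_contra hcon
      push Not at hcon
      exact absurd (Finset.card_le_card (show K ⊆ U from hcon)) (by omega)
    obtain ⟨z, hz⟩ : l.toFinset.Nonempty := Finset.card_pos.mp (by omega)
    -- The balls of radius 4 around the chosen nodes do not exhaust `K`, so an edge leaves their
    -- union. Its outer end `c` is more than 4 away from all chosen nodes and at most 5 away from
    -- one of them.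
    obtain ⟨a, ha, c, hc, hac, haU, hcU⟩ := hconn U ⟨z, hlK hz, hself z hz⟩ ⟨y, hy, hyU⟩
    obtain ⟨u, hu, hau⟩ := Finset.mem_biUnion.mp haU
    have huc : G.edist u c ≤ 5 := by
      calc G.edist u c ≤ G.edist u a + G.edist a c := SimpleGraph.edist_triangle
        _ ≤ 4 + 1 := add_le_add ((mem_nodeBall G).mp hau)
            (SimpleGraph.edist_eq_one_iff_adj.mpr hac).le
        _ = 5 := by norm_num
    have hcl : c ∉ l.toFinset := fun h => hcU (hself c h)
    obtain ⟨l₁, l₂, hl⟩ := List.append_of_mem (List.mem_toFinset.mp hu)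
    have hset : (l₁ ++ u :: c :: u :: l₂).toFinset = insert c l.toFinset := by
      ext w
      simp only [hl, List.mem_toFinset, List.mem_append, List.mem_cons, Finset.mem_insert]
      tauto
    refine ⟨l₁ ++ u :: c :: u :: l₂, ?_, ?_, ?_, ?_, ?_⟩
    · rw [hl] at hlen
      simp only [List.length_append, List.length_cons] at hlen ⊢
      omega
    · refine isChain_insert_detour (hl ▸ hchain) ?_ ((mem_nodeBall G).mpr huc)
      exact (mem_nodeBall G).mpr (SimpleGraph.edist_comm.trans_le huc)
    · rw [hset, Finset.card_insert_of_notMem hcl, hcard]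
    · rw [hset]
      exact Finset.insert_subset hc hlK
    · have hfar : ∀ w ∈ l.toFinset, c ∉ nodeBall G 4 w := fun w hw h =>
        hcU (Finset.mem_biUnion.mpr ⟨w, hw, h⟩)
      rw [hset]
      intro w hw w' hw' hne
      rcases Finset.mem_insert.mp hw with h1 | h1 <;>
        rcases Finset.mem_insert.mp hw' with h2 | h2
      · exact absurd (h1.trans h2.symm) hne
      · intro h
        refine hfar w' h2 ((mem_nodeBall G).mpr ?_)
        rw [h1] at h
        exact SimpleGraph.edist_comm.trans_le ((mem_nodeBall G).mp h)
      · rw [h2]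
        exact hfar w h1
      · exact hsep w h1 w' h2 hne

lemma exists_list_of_large_component (B : Finset V)
    (K : (G.induce (B : Set V)).ConnectedComponent) (s : ℕ)
    (hs : s * (G.maxDegree + 1) ^ 4 < K.supp.ncard) :
    ∃ l ∈ stepLists G 5 (2 * s), l.toFinset.card = s + 1 ∧
      (∀ u ∈ l.toFinset, ∀ v ∈ l.toFinset, u ≠ v → v ∉ nodeBall G 4 u) ∧
      ∀ v ∈ l.toFinset, v ∈ B := by
  classical
  set S : Finset V := (Subtype.val '' K.supp).toFinset with hS
  have hmem : ∀ {v}, v ∈ S ↔ ∃ h : v ∈ B, (⟨v, h⟩ : (B : Set V)) ∈ K.supp := by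
    intro v
    simp [hS]
  have hcard : S.card = K.supp.ncard := by
    rw [← Set.ncard_image_of_injective K.supp Subtype.val_injective, Set.ncard_eq_toFinset_card']
  have hne : S.Nonempty := Finset.card_pos.mp (by omega)
  have hconn : ∀ U : Finset V, (∃ x ∈ S, x ∈ U) → (∃ y ∈ S, y ∉ U) →
      ∃ a ∈ S, ∃ c ∈ S, G.Adj a c ∧ a ∈ U ∧ c ∉ U := by
    rintro U ⟨x, hx, hxU⟩ ⟨y, hy, hyU⟩
    obtain ⟨hxB, hxK⟩ := hmem.mp hx
    obtain ⟨hyB, hyK⟩ := hmem.mp hy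
    have hreach : (G.induce (B : Set V)).Reachable ⟨x, hxB⟩ ⟨y, hyB⟩ :=
      SimpleGraph.ConnectedComponent.exact
        (((SimpleGraph.ConnectedComponent.mem_supp_iff _ _).mp hxK).trans
          ((SimpleGraph.ConnectedComponent.mem_supp_iff _ _).mp hyK).symm)
    obtain ⟨p⟩ := hreach
    obtain ⟨d, hd, h1, h2⟩ := p.exists_boundary_dart {w | w.1 ∈ U} hxU hyU
    have hfst : d.fst ∈ K.supp := by
      have hr : (G.induce (B : Set V)).Reachable d.fst ⟨x, hxB⟩ :=
        ⟨(p.takeUntil _ (p.dart_fst_mem_support_of_mem_darts hd)).reverse⟩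
      rw [SimpleGraph.ConnectedComponent.mem_supp_iff] at hxK ⊢
      rw [← hxK]
      exact SimpleGraph.ConnectedComponent.sound hr
    have hsnd : d.snd ∈ K.supp := by
      rw [SimpleGraph.ConnectedComponent.mem_supp_iff] at hfst ⊢
      rw [← hfst]
      exact SimpleGraph.ConnectedComponent.sound d.adj.reachable.symm
    exact ⟨d.fst, hmem.mpr ⟨d.fst.2, hfst⟩, d.snd, hmem.mpr ⟨d.snd.2, hsnd⟩, d.adj, h1, h2⟩
  obtain ⟨l, hlen, hchain, hlcard, hlS, hsep⟩ :=
    exists_separated_list G S hne hconn s (by omega)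
  exact ⟨l, mem_stepLists G hchain hlen, hlcard, hsep, fun v hv => (hmem.mp (hlS hv)).1⟩

end Shattering

/-! ### The union bound over lists. -/

lemma succ_pow_four_le {D : ℝ} (hD : 3 ≤ D) : (D + 1) ^ 4 ≤ 4 * D ^ 4 := by
  have h1 : D + 1 ≤ 4 / 3 * D := by linarith
  calc (D + 1) ^ 4 ≤ (4 / 3 * D) ^ 4 := pow_le_pow_left₀ (by linarith) h1 4
    _ = 256 / 81 * D ^ 4 := by ring
    _ ≤ 4 * D ^ 4 := by
        have : 0 ≤ D ^ 4 := by positivity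
        linarith

/-- Per chosen node, the lists cost at most `D^20` and the factor `n^11` costs `D^11`, well below
the available `D^99`. -/
lemma union_bound_le {n D : ℝ} (hD : 3 ≤ D) (hn : 1 ≤ n) {s : ℕ} (hs : n ≤ D ^ (s + 1)) :
    n * ((D + 1) ^ 5) ^ (2 * s) * (1 / D ^ 99) ^ (s + 1) ≤ 1 / n ^ 10 := by
  have hD0 : 0 < D := by linarith
  have h1 : (D + 1) ^ 5 ≤ D ^ 10 := by
    calc (D + 1) ^ 5 ≤ (D ^ 2) ^ 5 := pow_le_pow_left₀ (by linarith) (by nlinarith) 5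
      _ = D ^ 10 := by ring
  have h2 : ((D + 1) ^ 5) ^ (2 * s) ≤ (D ^ 20) ^ (s + 1) := by
    calc ((D + 1) ^ 5) ^ (2 * s) ≤ (D ^ 10) ^ (2 * s) := pow_le_pow_left₀ (by positivity) h1 _
      _ ≤ (D ^ 10) ^ (2 * (s + 1)) :=
          pow_le_pow_right₀ (one_le_pow₀ (by linarith)) (by omega)
      _ = (D ^ 20) ^ (s + 1) := by rw [pow_mul, ← pow_mul D]
  have h3 : n ^ 11 ≤ (D ^ 11) ^ (s + 1) := by
    rw [pow_right_comm]
    exact pow_le_pow_left₀ (by linarith) hs 11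
  rw [one_div_pow, mul_one_div, div_le_div_iff₀ (by positivity) (by positivity), one_mul]
  calc n * ((D + 1) ^ 5) ^ (2 * s) * n ^ 10 = n ^ 11 * ((D + 1) ^ 5) ^ (2 * s) := by ring
    _ ≤ (D ^ 11) ^ (s + 1) * (D ^ 20) ^ (s + 1) :=
        mul_le_mul h3 h2 (by positivity) (by positivity)
    _ = (D ^ 31) ^ (s + 1) := by rw [← mul_pow]; ring
    _ ≤ (D ^ 99) ^ (s + 1) :=
        pow_le_pow_left₀ (by positivity) (pow_le_pow_right₀ (by linarith) (by norm_num)) _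

section Main

variable {V : Type*} [Fintype V] [DecidableEq V] (G : SimpleGraph V) [DecidableRel G.Adj]
variable {k b : ℕ} (R L : ℕ)

lemma le_avg_componentsAtMost (hR : 0 < R) (hb : R * 2 ^ L < b) (hΔ : 3 ≤ G.maxDegree) {C : ℝ}
    (hC : iterConst ≤ C) (hT : iterConst * Real.logb 2 G.maxDegree ≤ ((R * 2 ^ L : ℕ) : ℝ))
    (hk : 12 * C * Real.logb 2 G.maxDegree ≤ k) (x : CoinIndex V (R * 2 ^ L) k → Number b) :
    1 - 1 / (Fintype.card V : ℝ) ^ 10 ≤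
      avg (pastBlock (R * 2 ^ L) k (R * 2 ^ L) Finset.univ)
      (fun z => ind (toCoins z ∈ componentsAtMost G R L k b
        (4 * (Real.logb G.maxDegree (Fintype.card V) * (G.maxDegree : ℝ) ^ 4)))) x := by
  classical
  set n : ℝ := (Fintype.card V : ℝ) with hn
  set D : ℝ := (G.maxDegree : ℝ) with hD
  have hD3 : 3 ≤ D := by rw [hD]; exact_mod_cast hΔ
  have hDn : D < n := by
    have hV : Nonempty V := by
      by_contra hV
      rw [not_nonempty_iff] at hV
      have : G.maxDegree = 0 := by simp
      omega
    have := G.maxDegree_lt_card_verts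
    rw [hD, hn]
    exact_mod_cast this
  set lam := Real.logb D n with hlam
  have hlam1 : 1 ≤ lam := by
    rw [hlam, Real.le_logb_iff_rpow_le (by linarith) (by linarith), Real.rpow_one]
    exact hDn.le
  -- The largest integer below `lam`: `s < lam` keeps `s * (D + 1)^4` within the claimed component
  -- size, and `s + 1 ≥ lam` gives `n ≤ D ^ (s + 1)` for the union bound.
  set s := ⌈lam⌉₊ - 1 with hs
  have hceil : ⌈lam⌉₊ = s + 1 := by
    have : 0 < ⌈lam⌉₊ := Nat.ceil_pos.mpr (by linarith)
    omega
  have hs1 : (s : ℝ) < lam := by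
    have := Nat.ceil_lt_add_one (a := lam) (by linarith)
    rw [hceil] at this
    push_cast at this
    linarith
  have hs2 : n ≤ D ^ (s + 1) := by
    have h1 : lam ≤ ((s + 1 : ℕ) : ℝ) := hceil ▸ Nat.le_ceil lam
    calc n = D ^ lam := (Real.rpow_logb (by linarith) (by linarith) (by linarith)).symm
      _ ≤ D ^ ((s + 1 : ℕ) : ℝ) := Real.rpow_le_rpow_of_exponent_le (by linarith) h1
      _ = D ^ (s + 1) := Real.rpow_natCast _ _
  set 𝒲 := (stepLists G 5 (2 * s)).filter fun l => l.toFinset.card = s + 1 ∧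
      ∀ u ∈ l.toFinset, ∀ v ∈ l.toFinset, u ≠ v → v ∉ nodeBall G 4 u with hW
  set E := componentsAtMost G R L k b (4 * (lam * D ^ 4)) with hE
  have hbad : ∀ z : CoinIndex V (R * 2 ^ L) k → Number b, ind (¬ toCoins z ∈ E) ≤
      ∑ l ∈ 𝒲, ind (∀ v ∈ l.toFinset, v ∈ (runState G R L (R * 2 ^ L) z).alive) := by
    intro z
    refine ind_le_sum fun hz => ?_
    simp only [hE, componentsAtMost, Set.mem_ofPred_eq, not_forall, not_le] at hz
    obtain ⟨K, hK⟩ := hz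
    obtain ⟨l, hl, h1, h2, h3⟩ := exists_list_of_large_component G _ K s (by
      have h4 := succ_pow_four_le hD3
      have h5 : (s : ℝ) * (D + 1) ^ 4 < K.supp.ncard := by
        refine lt_of_le_of_lt ?_ hK
        calc (s : ℝ) * (D + 1) ^ 4 ≤ lam * (4 * D ^ 4) :=
              mul_le_mul hs1.le h4 (by positivity) (by linarith)
          _ = _ := by ring
      rw [hD] at h5
      exact_mod_cast h5)
    exact ⟨l, Finset.mem_filter.mpr ⟨hl, h1, h2⟩, h3⟩
  have hterm : ∀ l ∈ 𝒲, avg (pastBlock (R * 2 ^ L) k (R * 2 ^ L) Finset.univ) (fun z =>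
      ind (∀ v ∈ l.toFinset, v ∈ (runState G R L (R * 2 ^ L) z).alive)) x ≤
      (1 / D ^ 99) ^ (s + 1) := by
    intro l hl
    obtain ⟨_, h1, h2⟩ := Finset.mem_filter.mp hl
    rw [← h1]
    exact avg_alive_le_pow G R L hR hb hΔ hC hT hk l.toFinset Finset.univ
      (fun u hu v hv hne => disjoint_closedNbhd₂ G (h2 u hu v hv hne))
      (fun v _ => Finset.subset_univ _) x
  have hcard : (𝒲.card : ℝ) ≤ n * ((D + 1) ^ 5) ^ (2 * s) := by
    have : 𝒲.card ≤ _ := (Finset.card_filter_le _ _).trans (card_stepLists_le G 5 (2 * s))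
    rw [hn, hD]
    exact_mod_cast this
  have hfinal : avg (pastBlock (R * 2 ^ L) k (R * 2 ^ L) Finset.univ)
      (fun z => ind (¬ toCoins z ∈ E)) x ≤ 1 / n ^ 10 := by
    calc _ ≤ avg (pastBlock (R * 2 ^ L) k (R * 2 ^ L) Finset.univ) (fun z =>
          ∑ l ∈ 𝒲, ind (∀ v ∈ l.toFinset, v ∈ (runState G R L (R * 2 ^ L) z).alive)) x :=
          avg_mono fun z _ => hbad z
      _ = ∑ l ∈ 𝒲, _ := avg_sum _ _ _ _
      _ ≤ ∑ l ∈ 𝒲, (1 / D ^ 99) ^ (s + 1) := Finset.sum_le_sum hterm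
      _ = 𝒲.card * (1 / D ^ 99) ^ (s + 1) := by rw [Finset.sum_const, nsmul_eq_mul]
      _ ≤ n * ((D + 1) ^ 5) ^ (2 * s) * (1 / D ^ 99) ^ (s + 1) :=
          mul_le_mul_of_nonneg_right hcard (by positivity)
      _ ≤ 1 / n ^ 10 := union_bound_le hD3 (by linarith) hs2
  simp only [ind_not] at hfinal
  rw [avg_sub, avg_const] at hfinal
  linarith

end Main

end RecursiveMIS

/-! ### The theorem. -/

theorem mainTheorem4 :
    ∃ c₀ C₀ K : ℝ, 0 < c₀ ∧ 0 < C₀ ∧ 0 < K ∧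
      ∀ (V : Type*) [Fintype V] [DecidableEq V] (G : SimpleGraph V) [DecidableRel G.Adj]
        (n Δ : ℕ), n = Fintype.card V → Δ = G.maxDegree → 3 ≤ Δ →
      ∀ (c C : ℝ), c₀ ≤ c → C₀ ≤ C →
      ∀ (R L k b : ℕ),
        2 * Real.logb 2 (Real.logb 2 Δ) < R → R ≤ 4 * Real.logb 2 (Real.logb 2 Δ) →
        ((R * 2 ^ L : ℕ) : ℝ) = c * Real.logb 2 Δ →
        k = ⌈12 * C * Real.logb 2 Δ⌉₊ →
        R * 2 ^ L < b →
      (∀ v : V,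
        1 - 1 / (Δ : ℝ) ^ 98 ≤
          (RecursiveMIS.coinMeasure V (R * 2 ^ L) k b).real (RecursiveMIS.covered G R L k b v) ∧
        ∀ η : RecursiveMIS.Coins V (R * 2 ^ L) k b,
          1 - 1 / (Δ : ℝ) ^ 98 ≤
            ((RecursiveMIS.coinMeasure V (R * 2 ^ L) k b)[|RecursiveMIS.outsideCoins G v η]).real
              (RecursiveMIS.covered G R L k b v)) ∧
      1 - 1 / (n : ℝ) ^ 10 ≤
        (RecursiveMIS.coinMeasure V (R * 2 ^ L) k b).real
          (RecursiveMIS.componentsAtMost G R L k b (K * (Real.logb Δ n * (Δ : ℝ) ^ 4))) := by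
  open RecursiveMIS in
  have hc := iterConst_ge
  -- The 4 is the constant in `(Δ + 1)^4 ≤ 4 * Δ^4`, which passes from ball sizes to powers of `Δ`.
  refine ⟨iterConst, iterConst, 4, by linarith, by linarith, by norm_num, ?_⟩
  intro V _ _ G _ n Δ hn hΔG hΔ c C hc₀ hC₀ R L k b hR1 hR2 hT hk hb
  subst hn hΔG
  have hΔ' : (3 : ℝ) ≤ G.maxDegree := by exact_mod_cast hΔ
  have hlg : 1 < Real.logb 2 (G.maxDegree : ℝ) := by
    rw [Real.lt_logb_iff_rpow_lt (by norm_num) (by linarith), Real.rpow_one]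
    linarith
  have hR : 0 < R := by
    have := Real.logb_pos (b := 2) (by norm_num) hlg
    have : (0 : ℝ) < R := by linarith
    exact_mod_cast this
  have hT' : iterConst * Real.logb 2 G.maxDegree ≤ ((R * 2 ^ L : ℕ) : ℝ) := by
    rw [hT]; exact mul_le_mul_of_nonneg_right hc₀ (by linarith)
  have hk' : 12 * C * Real.logb 2 G.maxDegree ≤ k := hk ▸ Nat.le_ceil _
  -- An arbitrary base point: averaging over the coins of all nodes overwrites every coordinate.
  let ω₀ : Coins V (R * 2 ^ L) k b := fun _ _ => (fun _ => 0, 0)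
  refine ⟨fun v => ⟨?_, fun η => ?_⟩, ?_⟩
  · rw [coinMeasure_real_eq_avg ω₀]
    exact le_avg_covered G R L hR hb hΔ hC₀ hT' hk' v _ (Finset.subset_univ _) _
  · rw [coinMeasure_cond_outsideCoins G v η (nodeBall G 2 v)
      (fun u => by rw [mem_nodeBall]; rfl), uniformOn_real_eq_avg]
    exact le_avg_covered G R L hR hb hΔ hC₀ hT' hk' v _
      (fun u hu => (mem_nodeBall G).mpr (edist_le_two_of_mem_closedNbhd₂ G hu)) _
  · rw [coinMeasure_real_eq_avg ω₀]
    exact le_avg_componentsAtMost G R L hR hb hΔ hC₀ hT' hk' _
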